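/- Let $M$ be a smooth manifold of dimension $n$ (Hausdorff, second countable), let $g$ be a smooth pseudo-Riemannian metric of arbitrary signature on $M$ with Levi-Civita connection $\nabla$, and let $L$ be a smooth $(1,1)$-tensor field on $M$ that is compatible with $g$, i.e. $L$ is $g$-selfadjoint, nondegenerate at every point, and satisfies $$\nabla_u L=\tfrac12\bigl(u\otimes d\,\mathrm{tr}\,L+(u\otimes d\,\mathrm{tr}\,L)^*\bigr)$$ for every tangent vector $u$, where $u\otimes\alpha$ denotes the endomorphism $v\mapsto\alpha(v)u$ and $*$ the $g$-adjoint. The geometric multiplicity of $\mu\in\mathbb C$ for $L$ at $x$ is the complex dimension of the kernel of $L_x-\mu\cdot\mathbf 1$ on $\mathbb C\otimes T_xM$; eigenvalues are those of $L_x$ on $\mathbb C\otimes T_xM$. (1) Let $U$ be a connected open neighbourhood of a point $p\in M$, and suppose that either at every $x\in U$ the operator $L$ has exactly one eigenvalue $\lambda(x)$, and it is real, or there is a continuous function $\lambda:U\to\mathbb C\setminus\mathbb R$ such that at every $x\in U$ the eigenvalues of $L$ are exactly $\lambda(x)$ and $\overline{\lambda(x)}$. Suppose that the geometric multiplicity of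 $\lambda(x)$ is at least two at each $x\in U$. Then $\lambda$ is constant on $U$ and $\nabla L=0$ on $U$. Moreover $\bar g(\cdot,\cdot)=\frac1{|\det L|}\,g(L^{-1}\cdot,\cdot)$ is a pseudo-Riemannian metric on $M$, and $g$ and $\bar g$ are affinely equivalent on $U$, i.e. their Levi-Civita connections coincide there. (2) Suppose in addition that $M$ is connected. Let $U\subseteq M$ be a nonempty connected open set and $\lambda:U\to\mathbb C$ a continuous (possibly real-valued) function such that for every $x\in U$ the number $\lambda(x)$ is an eigenvalue of $L$ at $x$ of geometric multiplicity at least two. Then $\lambda$ is constant on $U$, and this constant is an eigenvalue of $L$ of geometric multiplicity at least two at every point $x\in M$. -/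

import Mathlib

open scoped Manifold ContDiff Topology

noncomputable section

namespace GeodEquiv

/-! Throughout, `M` is a manifold modelled on `ℝⁿ`.  A field of bilinear forms is a map `x ↦ g x`
with `g x` a bilinear form on `T_x M`; a `(1,1)`-tensor is a map `x ↦ L x` with `L x` an
endomorphism of `T_x M`. -/

section Fields

variable {n : ℕ} {M : Type*} [TopologicalSpace M] [ChartedSpace (EuclideanSpace ℝ (Fin n)) M]

/-- Fields of bilinear forms on the tangent spaces of `M`. -/
abbrev BilinField (n : ℕ) (M : Type*) [TopologicalSpace M]
    [ChartedSpace (EuclideanSpace ℝ (Fin n)) M] : Type _ :=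
  ∀ x : M, TangentSpace (𝓡 n) x →L[ℝ] TangentSpace (𝓡 n) x →L[ℝ] ℝ

/-- Fields of endomorphisms of the tangent spaces of `M`, i.e. `(1,1)`-tensors. -/
abbrev EndField (n : ℕ) (M : Type*) [TopologicalSpace M]
    [ChartedSpace (EuclideanSpace ℝ (Fin n)) M] : Type _ :=
  ∀ x : M, TangentSpace (𝓡 n) x →L[ℝ] TangentSpace (𝓡 n) x

/-- `g` is a (smooth) pseudo-Riemannian metric, of arbitrary signature. -/
structure IsPseudoRiemannianMetric [IsManifold (𝓡 n) ∞ M] (g : BilinField n M) : Prop where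
  symm : ∀ (x : M) (u v : TangentSpace (𝓡 n) x), g x u v = g x v u
  nondegenerate : ∀ (x : M) (u : TangentSpace (𝓡 n) x), (∀ v, g x u v = 0) → u = 0
  contMDiff : ContMDiff (𝓡 n)
    ((𝓡 n).prod 𝓘(ℝ, EuclideanSpace ℝ (Fin n) →L[ℝ] EuclideanSpace ℝ (Fin n) →L[ℝ] ℝ)) ∞
    (fun x ↦ Bundle.TotalSpace.mk'
      (EuclideanSpace ℝ (Fin n) →L[ℝ] EuclideanSpace ℝ (Fin n) →L[ℝ] ℝ)
      (E := fun x : M ↦ TangentSpace (𝓡 n) x →L[ℝ] TangentSpace (𝓡 n) x →L[ℝ] ℝ) x (g x))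

/-- `L` is a smooth `(1,1)`-tensor. -/
def IsSmoothEndField [IsManifold (𝓡 n) ∞ M] (L : EndField n M) : Prop :=
  ContMDiff (𝓡 n)
    ((𝓡 n).prod 𝓘(ℝ, EuclideanSpace ℝ (Fin n) →L[ℝ] EuclideanSpace ℝ (Fin n))) ∞
    (fun x ↦ Bundle.TotalSpace.mk' (EuclideanSpace ℝ (Fin n) →L[ℝ] EuclideanSpace ℝ (Fin n))
      (E := fun x : M ↦ TangentSpace (𝓡 n) x →L[ℝ] TangentSpace (𝓡 n) x) x (L x))

/-! ### Coordinate expressions in the preferred chart `φ` at `c`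

In Mathlib the tangent space at `c` is identified with the model space `ℝⁿ` through the
differential of exactly this chart at `c`, so that at the point `φ c` the coordinate expression of
a tensor is the tensor at `c` itself. -/

/-- `y ↦ D(φ⁻¹)(y)`, from `ℝⁿ` to the tangent space of `M` at `φ⁻¹ y`. -/
def chartFrame (c : M) (y : EuclideanSpace ℝ (Fin n)) :
    EuclideanSpace ℝ (Fin n) →L[ℝ] TangentSpace (𝓡 n) ((extChartAt (𝓡 n) c).symm y) :=
  mfderiv 𝓘(ℝ, EuclideanSpace ℝ (Fin n)) (𝓡 n) (extChartAt (𝓡 n) c).symm y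

/-- `y ↦ Dφ(φ⁻¹ y)`, from the tangent space of `M` at `φ⁻¹ y` to `ℝⁿ`. -/
def chartCoframe (c : M) (y : EuclideanSpace ℝ (Fin n)) :
    TangentSpace (𝓡 n) ((extChartAt (𝓡 n) c).symm y) →L[ℝ] EuclideanSpace ℝ (Fin n) :=
  mfderiv (𝓡 n) 𝓘(ℝ, EuclideanSpace ℝ (Fin n)) (extChartAt (𝓡 n) c)
    ((extChartAt (𝓡 n) c).symm y)

/-- The components `g_{ij}` of `g` as a function of the coordinates:
`(u, v) ↦ g (D(φ⁻¹)(y) u, D(φ⁻¹)(y) v)`. -/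
def bilinInChart (g : BilinField n M) (c : M) (y : EuclideanSpace ℝ (Fin n)) :
    EuclideanSpace ℝ (Fin n) →L[ℝ] EuclideanSpace ℝ (Fin n) →L[ℝ] ℝ :=
  ContinuousLinearMap.precomp ℝ (chartFrame c y) ∘L
    g ((extChartAt (𝓡 n) c).symm y) ∘L chartFrame c y

/-- The components `L^i_j` of `L` as a function of the coordinates. -/
def endInChart (L : EndField n M) (c : M) (y : EuclideanSpace ℝ (Fin n)) :
    EuclideanSpace ℝ (Fin n) →L[ℝ] EuclideanSpace ℝ (Fin n) :=
  chartCoframe c y ∘L L ((extChartAt (𝓡 n) c).symm y) ∘L chartFrame c y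

/-- The components `Y^i` of a vector field `Y` as a function of the coordinates. -/
def vectorInChart (Y : ∀ x : M, TangentSpace (𝓡 n) x) (c : M)
    (y : EuclideanSpace ℝ (Fin n)) : EuclideanSpace ℝ (Fin n) :=
  chartCoframe c y (Y ((extChartAt (𝓡 n) c).symm y))

/-- The Christoffel symbols `Γ(u, v)` at `y` of a matrix function `G` on `ℝⁿ`:
`Γ^k_{ij} = ½ G^{kl} (∂_i G_{jl} + ∂_j G_{il} - ∂_l G_{ij})`, where `G^{kl}` is the inverse matrix
(the inverse of `G y` as a map from `ℝⁿ` to its dual). -/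
def christoffelCoord
    (G : EuclideanSpace ℝ (Fin n) → EuclideanSpace ℝ (Fin n) →L[ℝ] EuclideanSpace ℝ (Fin n) →L[ℝ] ℝ)
    (y u v : EuclideanSpace ℝ (Fin n)) : EuclideanSpace ℝ (Fin n) :=
  ContinuousLinearMap.inverse (G y)
    ((1 / 2 : ℝ) • (fderiv ℝ G y u v + fderiv ℝ G y v u - ((fderiv ℝ G y).flip u).flip v))

/-- `∇_u Y` at `y` in coordinates: `∇_k Y^i = ∂_k Y^i + Γ^i_{kl} Y^l`. -/
def covDerivVectorCoord
    (G : EuclideanSpace ℝ (Fin n) → EuclideanSpace ℝ (Fin n) →L[ℝ] EuclideanSpace ℝ (Fin n) →L[ℝ] ℝ)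
    (Y : EuclideanSpace ℝ (Fin n) → EuclideanSpace ℝ (Fin n)) (y u : EuclideanSpace ℝ (Fin n)) :
    EuclideanSpace ℝ (Fin n) :=
  fderiv ℝ Y y u + christoffelCoord G y u (Y y)

/-- `(∇_u A)(v)` at `y` in coordinates:
`∇_k A^i_j = ∂_k A^i_j + Γ^i_{kl} A^l_j - A^i_l Γ^l_{kj}`. -/
def covDerivEndCoord
    (G : EuclideanSpace ℝ (Fin n) → EuclideanSpace ℝ (Fin n) →L[ℝ] EuclideanSpace ℝ (Fin n) →L[ℝ] ℝ)
    (A : EuclideanSpace ℝ (Fin n) → EuclideanSpace ℝ (Fin n) →L[ℝ] EuclideanSpace ℝ (Fin n))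
    (y u v : EuclideanSpace ℝ (Fin n)) : EuclideanSpace ℝ (Fin n) :=
  fderiv ℝ A y u v + christoffelCoord G y u (A y v) - A y (christoffelCoord G y u v)

/-- The Levi-Civita connection of `g`; `leviCivita g Y x u` is `∇_u Y` at `x`, computed in the
preferred chart at `x`. -/
def leviCivita (g : BilinField n M) (Y : ∀ x : M, TangentSpace (𝓡 n) x) (x : M)
    (u : TangentSpace (𝓡 n) x) : TangentSpace (𝓡 n) x :=
  covDerivVectorCoord (bilinInChart g x) (vectorInChart Y x) (extChartAt (𝓡 n) x x) u

/-- The covariant derivative of a `(1,1)`-tensor with respect to the Levi-Civita connection of `g`;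
`covDerivEnd g L x u v` is `(∇_u L)(v)` at `x`, computed in the preferred chart at `x`. -/
def covDerivEnd (g : BilinField n M) (L : EndField n M) (x : M) (u v : TangentSpace (𝓡 n) x) :
    TangentSpace (𝓡 n) x :=
  covDerivEndCoord (bilinInChart g x) (endInChart L x) (extChartAt (𝓡 n) x x) u v

/-- The differential at `x` of the function `tr L`. -/
def dTrace (L : EndField n M) (x : M) : TangentSpace (𝓡 n) x →L[ℝ] ℝ :=
  mfderiv (𝓡 n) 𝓘(ℝ, ℝ)
    (fun y : M ↦ LinearMap.trace ℝ (TangentSpace (𝓡 n) y) (L y).toLinearMap) x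

/-- The endomorphism `u ⊗ α : v ↦ α(v) u`. -/
def tensorEnd {x : M} (u : TangentSpace (𝓡 n) x) (α : TangentSpace (𝓡 n) x →L[ℝ] ℝ) :
    TangentSpace (𝓡 n) x →L[ℝ] TangentSpace (𝓡 n) x :=
  α.smulRight u

/-- The `g`-adjoint `A*` of an endomorphism `A` of `T_x M`: `g (A* v, w) = g (v, A w)`. -/
def gAdjoint (g : BilinField n M) {x : M} (A : TangentSpace (𝓡 n) x →L[ℝ] TangentSpace (𝓡 n) x) :
    TangentSpace (𝓡 n) x →L[ℝ] TangentSpace (𝓡 n) x :=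
  ContinuousLinearMap.inverse (g x) ∘L ContinuousLinearMap.precomp ℝ A ∘L g x

/-- The smooth `(1,1)`-tensor `L` is compatible with `g`: it is `g`-selfadjoint, nondegenerate at
every point, and `∇_u L = ½ (u ⊗ d tr L + (u ⊗ d tr L)*)` for all tangent vectors `u`. -/
structure Compatible [IsManifold (𝓡 n) ∞ M] (g : BilinField n M) (L : EndField n M) : Prop where
  smooth : IsSmoothEndField L
  selfadjoint : ∀ (x : M) (u v : TangentSpace (𝓡 n) x), g x (L x u) v = g x u (L x v)
  nondegenerate : ∀ x : M, LinearMap.det (L x).toLinearMap ≠ 0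
  main : ∀ (x : M) (u v : TangentSpace (𝓡 n) x),
    covDerivEnd g L x u v =
      (1 / 2 : ℝ) • (tensorEnd u (dTrace L x) + gAdjoint g (tensorEnd u (dTrace L x))) v

/-- The field of bilinear forms `ḡ(u, v) = |det L|⁻¹ g(L⁻¹ u, v)`. -/
def gBar (g : BilinField n M) (L : EndField n M) : BilinField n M := fun x ↦
  (1 / |LinearMap.det (L x).toLinearMap|) • (g x ∘L ContinuousLinearMap.inverse (L x))

/-- `g` and `g'` are affinely equivalent on `U`: their Levi-Civita connections coincide there. -/
def AffinelyEquivalentOn [IsManifold (𝓡 n) ∞ M] (g g' : BilinField n M) (U : Set M) : Prop :=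
  ∀ x ∈ U, ∀ Y : ∀ y : M, TangentSpace (𝓡 n) y,
    MDifferentiableAt (𝓡 n) (𝓡 n).tangent
      (fun y ↦ (⟨y, Y y⟩ : TangentBundle (𝓡 n) M)) x →
    ∀ u : TangentSpace (𝓡 n) x, leviCivita g Y x u = leviCivita g' Y x u

/-- The complexification of `L x`, an endomorphism of `ℂ ⊗ T_x M`. -/
def complexify (L : EndField n M) (x : M) :
    Module.End ℂ (TensorProduct ℝ ℂ (TangentSpace (𝓡 n) x)) :=
  LinearMap.baseChange ℂ (L x).toLinearMap

/-- The set of all (real and non-real) eigenvalues of `L` at `x`. -/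
def eigenvalues (L : EndField n M) (x : M) : Set ℂ :=
  {μ | (complexify L x).HasEigenvalue μ}

/-- The geometric multiplicity of `μ` for `L` at `x`: the complex dimension of the eigenspace.
For real `μ` this is also the real dimension of the kernel of `L x - μ` on `T_x M`. -/
def geomMult (L : EndField n M) (x : M) (μ : ℂ) : ℕ :=
  Module.finrank ℂ ((complexify L x).eigenspace μ)

end Fields

end GeodEquiv

end

/-! ### Adjugates and kernels of dimension at least two. -/

section AdjugateRank

open Matrix Module

variable {ι K : Type*} [Fintype ι] [Field K]

/-! For a compatible pair, `det (1 - ε L) g((1 - ε L)⁻¹ v, v) = g(adj (1 - ε L) v, v)` is constant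
along every geodesic with velocity `v` (`hasDerivAt_firstIntegral`). It is a polynomial in `ε`, so
each geodesic carries one fixed polynomial (`killingPolynomial_eq`), and complex `ε` may be
inserted. An eigenvalue `μ`, nonzero since `L` is nondegenerate, has geometric multiplicity at least
two exactly when `adj (1 - μ⁻¹ L) = 0`; then `μ⁻¹` is a root of the polynomials of all vectors at
that point.

Constancy (`eventually_eq_of_aeval_killingPolynomial`): along a geodesic with `g(v, v) ≠ 0` the
polynomial is nonzero, its value at `0` being `g(v, v)`. A continuous function with values in its
finite root set is constant, so `1/λ` does not change along the geodesic. Null directions follow by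
continuity, because null vectors contain no nonempty open set. Since nearby points are joined by
geodesics, `λ` is locally constant.

Continuation (`exists_ball_adjugate_eq_zero`): if `1/μ` is a common root on an open set `W`, then at
a nearby `x` it is a root for the open set of velocities whose geodesics end in `W`. The form `g(adj
(1 - μ⁻¹ L) v, v)` is quadratic in `v`, hence zero, so `μ` has multiplicity at least two at `x`. A
clopen argument spreads this over a connected `M`.

In the local statement all eigenvalues have the same real part, so `tr L = n Re λ` is constant and
the compatibility equation gives `∇L = 0`. Then `det L` is stationary, the Levi-Civita connection of
`g` is also metric for `ḡ`, and uniqueness of the Levi-Civita connection identifies the two. -/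

theorem Matrix.finrank_ker_mulVecLin_add_rank (B : Matrix ι ι K) :
    finrank K (LinearMap.ker B.mulVecLin) + B.rank = Fintype.card ι := by
  rw [add_comm, Matrix.rank, LinearMap.finrank_range_add_finrank_ker, Module.finrank_fintype_fun_eq_card]

/-- In a space of dimension at least two a linear form has a nonzero zero. -/
theorem Submodule.exists_mem_ne_zero_apply_eq_zero {V : Type*} [AddCommGroup V] [Module K V]
    {S : Submodule K V} (hS : 2 ≤ finrank K S) (f : V →ₗ[K] K) : ∃ v ∈ S, v ≠ 0 ∧ f v = 0 := by
  have : FiniteDimensional K S := FiniteDimensional.of_finrank_pos (by omega)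
  have h : LinearMap.ker (f ∘ₗ S.subtype) ≠ ⊥ := by
    intro h
    have h1 := LinearMap.finrank_le_finrank_of_injective (LinearMap.ker_eq_bot.mp h)
    rw [finrank_self] at h1
    omega
  obtain ⟨⟨v, hv⟩, hvm, hv0⟩ := Submodule.exists_mem_ne_zero_of_ne_bot h
  exact ⟨v, hv, fun h ↦ hv0 (by simp [h]), by simpa using hvm⟩

variable [DecidableEq ι]

/-- The adjugate of a nonempty square matrix over a field vanishes iff the kernel has dimension at
least two. -/
theorem Matrix.adjugate_eq_zero_iff_finrank_ker [Nonempty ι] (B : Matrix ι ι K) :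
    B.adjugate = 0 ↔ 2 ≤ finrank K (LinearMap.ker B.mulVecLin) := by
  constructor
  · intro h
    have hdet : B.det = 0 := by
      have h1 := B.mul_adjugate
      rw [h, mul_zero] at h1
      have h2 := congrFun (congrFun h1 (Classical.arbitrary ι)) (Classical.arbitrary ι)
      simpa using h2.symm
    -- If the kernel is a line spanned by `v`, pick `v i ≠ 0`, and `w j ≠ 0` for a left null vector
    -- `w`. The entry `(i, j)` of the adjugate cannot vanish: its vanishing gives `z ≠ 0` with `z i
    -- = 0` and `B z` supported at `j`. Pairing with `w` gives `B z = 0`, so `z` is a multiple of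
    -- `v` with `z i = 0`, hence zero.
    by_contra hlt
    obtain ⟨v, hv0, hv⟩ := Matrix.exists_mulVec_eq_zero_iff.mpr hdet
    obtain ⟨w, hw0, hw⟩ := Matrix.exists_vecMul_eq_zero_iff.mpr hdet
    obtain ⟨i, hi⟩ := Function.ne_iff.mp hv0
    obtain ⟨j, hj⟩ := Function.ne_iff.mp hw0
    rw [Pi.zero_apply] at hi hj
    have hspan : ∀ z, B *ᵥ z = 0 → ∃ c : K, z = c • v := by
      intro z hz
      by_contra hne
      push Not at hne
      have hli : LinearIndependent K ![v, z] :=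
        (LinearIndependent.pair_iff' hv0).mpr fun a ha ↦ hne a ha.symm
      have hli' : LinearIndependent K
          (![⟨v, hv⟩, ⟨z, hz⟩] : Fin 2 → LinearMap.ker B.mulVecLin) := by
        apply LinearIndependent.of_comp (LinearMap.ker B.mulVecLin).subtype
        have hc : (LinearMap.ker B.mulVecLin).subtype ∘
            (![⟨v, hv⟩, ⟨z, hz⟩] : Fin 2 → LinearMap.ker B.mulVecLin) = ![v, z] := by
          ext k; fin_cases k <;> rfl
        rw [hc]
        exact hli
      have := hli'.fintype_card_le_finrank
      simp at this
      omega
    have hadj : (B.updateRow j (Pi.single i 1)).det = 0 := by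
      rw [← Matrix.adjugate_apply, h]; rfl
    obtain ⟨z, hz0, hz⟩ := Matrix.exists_mulVec_eq_zero_iff.mpr hadj
    have hzi : z i = 0 := by
      have := congrFun hz j
      simpa [Matrix.mulVec] using this
    have hzk : ∀ k, k ≠ j → (B *ᵥ z) k = 0 := by
      intro k hk
      have := congrFun hz k
      simpa [Matrix.mulVec, Matrix.updateRow_ne hk] using this
    have hBz : B *ᵥ z = 0 := by
      ext k
      by_cases hk : k = j
      · subst hk
        have h1 : w ⬝ᵥ (B *ᵥ z) = 0 := by rw [dotProduct_mulVec, hw, zero_dotProduct]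
        rw [dotProduct, Finset.sum_eq_single k (fun l _ hl ↦ by rw [hzk l hl, mul_zero])
          (by simp)] at h1
        exact (mul_eq_zero.mp h1).resolve_left hj
      · exact hzk k hk
    obtain ⟨c, rfl⟩ := hspan z hBz
    have hc : c = 0 := by simpa [hi] using hzi
    exact hz0 (by simp [hc])
  · intro h
    ext i j
    rw [Matrix.adjugate_apply, Matrix.zero_apply]
    -- A nonzero kernel vector with vanishing `i`-th coordinate is also killed by the matrix whose
    -- row `j` is replaced by the `i`-th unit row.
    obtain ⟨v, hv, hv0, hvi⟩ :=
      Submodule.exists_mem_ne_zero_apply_eq_zero h (LinearMap.proj (R := K) (φ := fun _ : ι ↦ K) i)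
    apply Matrix.exists_mulVec_eq_zero_iff.mp
    refine ⟨v, hv0, ?_⟩
    ext k
    by_cases hk : k = j
    · subst hk
      simpa [Matrix.mulVec] using hvi
    · have : (B *ᵥ v) k = 0 := congrFun (LinearMap.mem_ker.mp hv) k
      simpa [Matrix.mulVec, Matrix.updateRow_ne hk] using this

/-- The eigenvalue `μ ≠ 0` of the complexification of a real endomorphism with matrix `N` has
geometric multiplicity at least two iff `adj (1 - μ⁻¹ N) = 0`. -/
theorem LinearMap.two_le_finrank_eigenspace_baseChange_iff [Nonempty ι] {V : Type*} [AddCommGroup V]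
    [Module ℝ V] (b : Basis ι ℝ V) (f : V →ₗ[ℝ] V) {μ : ℂ} (hμ : μ ≠ 0) :
    2 ≤ finrank ℂ (Module.End.eigenspace (f.baseChange ℂ) μ) ↔
      (1 - μ⁻¹ • (LinearMap.toMatrix b b f).map (algebraMap ℝ ℂ)).adjugate = 0 := by
  rw [Matrix.adjugate_eq_zero_iff_finrank_ker]
  set F : TensorProduct ℝ ℂ V →ₗ[ℂ] TensorProduct ℝ ℂ V := 1 - μ⁻¹ • f.baseChange ℂ with hF
  have hmat : LinearMap.toMatrix (Algebra.TensorProduct.basis ℂ b) (Algebra.TensorProduct.basis ℂ b) F =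
      1 - μ⁻¹ • (LinearMap.toMatrix b b f).map (algebraMap ℝ ℂ) := by
    rw [hF, map_sub, map_smul, LinearMap.toMatrix_baseChange]
    congr 1
    exact LinearMap.toMatrix_one _
  have hker : Module.End.eigenspace (f.baseChange ℂ) μ = LinearMap.ker F := by
    ext z
    rw [Module.End.mem_eigenspace_iff, LinearMap.mem_ker, hF, LinearMap.sub_apply,
      Module.End.one_apply, LinearMap.smul_apply, sub_eq_zero, eq_comm, eq_inv_smul_iff₀ hμ]
  have : FiniteDimensional ℂ (TensorProduct ℝ ℂ V) := (Algebra.TensorProduct.basis ℂ b).finiteDimensional_of_finite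
  have h1 := LinearMap.finrank_range_add_finrank_ker F
  rw [Module.finrank_eq_card_basis (Algebra.TensorProduct.basis ℂ b)] at h1
  have h2 := Matrix.finrank_ker_mulVecLin_add_rank
    (1 - μ⁻¹ • (LinearMap.toMatrix b b f).map (algebraMap ℝ ℂ))
  rw [← hmat, Matrix.rank_eq_finrank_range_toLin _ (Algebra.TensorProduct.basis ℂ b) (Algebra.TensorProduct.basis ℂ b),
    Matrix.toLin_toMatrix] at h2
  rw [hker, ← hmat]
  omega

end AdjugateRank

/-! ### Smoothness and derivative of the determinant. -/

section Determinant

open Module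

variable {E : Type*} [NormedAddCommGroup E] [NormedSpace ℝ E] [FiniteDimensional ℝ E]

/-- By the Leibniz formula in a basis, the determinant is a polynomial in matrix entries, which are
continuous linear functions of `T`. -/
theorem contDiff_linearMap_det {k : WithTop ℕ∞} :
    ContDiff ℝ k (fun T : E →L[ℝ] E ↦ LinearMap.det (T : E →ₗ[ℝ] E)) := by
  let b := Module.finBasis ℝ E
  have h : (fun T : E →L[ℝ] E ↦ LinearMap.det (T : E →ₗ[ℝ] E)) = fun T : E →L[ℝ] E ↦
      ∑ σ : Equiv.Perm (Fin (finrank ℝ E)), (Equiv.Perm.sign σ : ℤ) •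
        ∏ i, (b.coord (σ i)).toContinuousLinearMap (T (b i)) := by
    ext T
    rw [← LinearMap.det_toMatrix b, Matrix.det_apply]
    simp [LinearMap.toMatrix_apply, Units.smul_def]
  rw [h]
  apply ContDiff.sum
  intro σ _
  simp only [zsmul_eq_mul]
  apply contDiff_const.mul
  apply contDiff_prod
  intro i _
  exact (ContinuousLinearMap.contDiff _).comp
    ((ContinuousLinearMap.apply ℝ E (b i)).contDiff)

/-- Jacobi's formula at an invertible endomorphism. -/
theorem fderiv_linearMap_det {T T' : E →L[ℝ] E} (hT : T ∘L T' = ContinuousLinearMap.id ℝ E)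
    (H : E →L[ℝ] E) :
    fderiv ℝ (fun T : E →L[ℝ] E ↦ LinearMap.det (T : E →ₗ[ℝ] E)) T H =
      LinearMap.det (T : E →ₗ[ℝ] E) *
        LinearMap.trace ℝ E ((T' ∘L H : E →L[ℝ] E) : E →ₗ[ℝ] E) := by
  have hd : DifferentiableAt ℝ (fun T : E →L[ℝ] E ↦ LinearMap.det (T : E →ₗ[ℝ] E)) T :=
    contDiff_linearMap_det.differentiable (n := 1) one_ne_zero T
  have hline : HasDerivAt (fun r : ℝ ↦ T + r • H) H 0 := by
    simpa using ((hasDerivAt_id (0 : ℝ)).smul_const H).const_add T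
  have h1 : HasDerivAt (fun r : ℝ ↦ LinearMap.det ((T + r • H : E →L[ℝ] E) : E →ₗ[ℝ] E))
      (fderiv ℝ (fun T : E →L[ℝ] E ↦ LinearMap.det (T : E →ₗ[ℝ] E)) T H) 0 := by
    have hd' : HasFDerivAt (fun T : E →L[ℝ] E ↦ LinearMap.det (T : E →ₗ[ℝ] E))
        (fderiv ℝ (fun T : E →L[ℝ] E ↦ LinearMap.det (T : E →ₗ[ℝ] E)) T) (T + (0 : ℝ) • H) := by
      simpa using hd.hasFDerivAt
    exact hd'.comp_hasDerivAt (0 : ℝ) hline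
  let b := Module.finBasis ℝ E
  set N := LinearMap.toMatrix b b ((T' ∘L H : E →L[ℝ] E) : E →ₗ[ℝ] E) with hN
  -- Factor `T + r H = T (1 + r T' H)` and expand `det (1 + r N) = 1 + r tr N + O(r²)`; the
  -- derivative at `r = 0` can then be read off.
  have h2 : ∀ r : ℝ, LinearMap.det ((T + r • H : E →L[ℝ] E) : E →ₗ[ℝ] E) =
      LinearMap.det (T : E →ₗ[ℝ] E) * (1 + N.trace * r +
        ((1 + (Polynomial.X : Polynomial ℝ) • N.map Polynomial.C).det.divX.divX).eval r * r ^ 2) := by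
    intro r
    rw [← Matrix.det_one_add_smul, hN]
    have : T + r • H = T ∘L (ContinuousLinearMap.id ℝ E + r • (T' ∘L H)) := by
      rw [ContinuousLinearMap.comp_add, ContinuousLinearMap.comp_smul,
        ← ContinuousLinearMap.comp_assoc, hT]
      simp
    rw [this, ContinuousLinearMap.toLinearMap_comp, LinearMap.det_comp]
    congr 1
    rw [← LinearMap.det_toMatrix b]
    congr 1
    rw [ContinuousLinearMap.toLinearMap_add, map_add, ContinuousLinearMap.toLinearMap_smul, map_smul]
    congr 1
    exact LinearMap.toMatrix_id _
  have h3 : HasDerivAt (fun r : ℝ ↦ LinearMap.det (T : E →ₗ[ℝ] E) * (1 + N.trace * r +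
        ((1 + (Polynomial.X : Polynomial ℝ) • N.map Polynomial.C).det.divX.divX).eval r * r ^ 2))
        (LinearMap.det (T : E →ₗ[ℝ] E) * N.trace) 0 := by
    have h4 := ((((hasDerivAt_id (0 : ℝ)).const_mul N.trace).const_add 1).add
      ((((1 + (Polynomial.X : Polynomial ℝ) • N.map Polynomial.C).det.divX.divX).hasDerivAt
        (0 : ℝ)).mul ((hasDerivAt_id (0 : ℝ)).pow 2))).const_mul (LinearMap.det (T : E →ₗ[ℝ] E))
    convert! h4 using 1
    simp
  rw [LinearMap.trace_eq_matrix_trace ℝ b]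
  exact (h1.congr_of_eventuallyEq (Filter.Eventually.of_forall fun r ↦ (h2 r).symm)).unique h3

end Determinant

/-! ### Second order equations: short solutions joining nearby points. -/

section SecondOrderFlow

variable {E : Type*} [NormedAddCommGroup E] [NormedSpace ℝ E] [CompleteSpace E]

open Metric Set NNReal in
/-- Second order autonomous equations `x'' = S (x, x')` for which constant curves are solutions
have, near every point, solutions with small initial velocities on a uniform time interval, and
any two nearby points are joined by one of them. -/
theorem exists_secondOrder_flow {S : E × E → E} {x₀ : E} (hS : ContDiffAt ℝ 1 S (x₀, 0))
    (h0 : ∀ᶠ x in 𝓝 x₀, S (x, 0) = 0) {O : Set E} (hO : O ∈ 𝓝 x₀) :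
    ∃ δ > 0, ∃ r > 0, ∃ T > 0, ∃ X V : E → E → ℝ → E, ball x₀ δ ⊆ O ∧ ∀ x ∈ ball x₀ δ,
      ContinuousOn (fun v ↦ X x v T) (ball 0 r) ∧
      ball x₀ δ ⊆ (fun v ↦ X x v T) '' ball 0 r ∧
      ∀ v ∈ ball (0 : E) r, X x v 0 = x ∧ V x v 0 = v ∧ ∀ s ∈ Icc 0 T, X x v s ∈ O ∧
        HasDerivAt (X x v) (V x v s) s ∧ HasDerivAt (V x v) (S (X x v s, V x v s)) s := by
  set Z : E × E → E × E := fun p ↦ (p.2, S p) with hZ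
  have hZc : ContDiffAt ℝ 1 Z (x₀, 0) := contDiffAt_snd.prodMk hS
  obtain ⟨K, s₀, hs₀, hK⟩ := hS.exists_lipschitzOnWith
  have hN : s₀ ∩ {p : E × E | p.1 ∈ O ∧ S (p.1, 0) = 0} ∈ 𝓝 ((x₀, 0) : E × E) := by
    refine Filter.inter_mem hs₀ ?_
    have h1 : ∀ᶠ x in 𝓝 x₀, x ∈ O ∧ S (x, 0) = 0 := (Filter.eventually_of_mem hO (fun _ h ↦ h)).and h0
    exact (continuous_fst.tendsto ((x₀, 0) : E × E)).eventually h1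
  obtain ⟨a₁, ha₁, hball⟩ := Metric.mem_nhds_iff.mp hN
  obtain ⟨ε, hε, a, r₁, L, K', hr₁, hpl⟩ := IsPicardLindelof.of_contDiffAt_one hZc
  obtain ⟨α, hα, L', hL'⟩ :=
    (hpl 0).exists_forall_mem_closedBall_eq_hasDerivWithinAt_lipschitzOnWith
  have hz₀ : ((x₀, 0) : E × E) ∈ closedBall ((x₀, 0) : E × E) r₁ := mem_closedBall_self r₁.2
  have hαd : ∀ z ∈ closedBall ((x₀, 0) : E × E) r₁, ∀ t ∈ Ioo (-ε) ε,
      HasDerivAt (α z) (Z (α z t)) t := fun z hz t ht ↦ by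
    have := (hα z hz).2 t ⟨by linarith [ht.1], by linarith [ht.2]⟩
    exact this.hasDerivAt (Icc_mem_nhds (by linarith [ht.1]) (by linarith [ht.2]))
  have hαc : ContinuousAt (α (x₀, 0)) 0 :=
    (hαd _ hz₀ 0 ⟨by linarith, hε⟩).continuousAt
  obtain ⟨τ, hτ, hτb⟩ := Metric.continuousAt_iff.mp hαc (a₁ / 2) (by positivity)
  have hα0 : α (x₀, 0) 0 = (x₀, 0) := (hα _ hz₀).1
  -- The three bounds keep `T` inside the existence interval, keep the solution from `(x₀, 0)`
  -- within `a₁ / 2` of its start, and give `K L' T ≤ 1/2`, where `K` is a Lipschitz constant of `S`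
  -- and `L'` one of the flow in its initial value.
  set T : ℝ := min (min (ε / 2) (τ / 2)) (1 / (2 * (K * L' + 1))) with hT
  have hTpos : 0 < T := by positivity
  have hTε : T < ε := by
    have : T ≤ ε / 2 := (min_le_left _ _).trans (min_le_left _ _)
    linarith
  have hTτ : T < τ := by
    have : T ≤ τ / 2 := (min_le_left _ _).trans (min_le_right _ _)
    linarith
  have hTK : K * L' * T ≤ 1 / 2 := by
    have h1 : T ≤ 1 / (2 * (K * L' + 1)) := min_le_right _ _
    have h2 : (0 : ℝ) ≤ K * L' := by positivity
    calc (K * L' * T : ℝ) ≤ (K * L' + 1) * (1 / (2 * (K * L' + 1))) := by gcongr; linarith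
      _ = 1 / 2 := by field_simp
  -- Initial values within `r` move a solution by at most `L' r ≤ a₁ / 2`, so all these solutions
  -- stay in the ball of radius `a₁`.
  set r : ℝ := min (r₁ : ℝ) (a₁ / (2 * (L' + 1))) with hr
  have hrpos : 0 < r := by positivity
  have hstay : ∀ z ∈ closedBall ((x₀, 0) : E × E) r, z ∈ closedBall ((x₀, 0) : E × E) r₁ ∧
      ∀ t ∈ Icc 0 T, α z t ∈ ball ((x₀, 0) : E × E) a₁ := by
    intro z hz
    have hz1 : z ∈ closedBall ((x₀, 0) : E × E) r₁ := closedBall_subset_closedBall (min_le_left _ _) hz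
    refine ⟨hz1, fun t ht ↦ ?_⟩
    have h1 : dist (α z t) (α (x₀, 0) t) ≤ L' * dist z (x₀, 0) :=
      (hL' t ⟨by linarith [ht.1], by linarith [ht.2]⟩).dist_le_mul _ hz1 _ hz₀
    have h2 : dist (α (x₀, 0) t) (x₀, 0) < a₁ / 2 := by
      have h := hτb (x := t) (by
        rw [Real.dist_eq, sub_zero, abs_of_nonneg ht.1]
        linarith [ht.2])
      rwa [hα0] at h
    have h3 : (L' : ℝ) * dist z (x₀, 0) ≤ a₁ / 2 := by
      have : dist z (x₀, 0) ≤ a₁ / (2 * (L' + 1)) := (mem_closedBall.1 hz).trans (min_le_right _ _)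
      calc (L' : ℝ) * dist z (x₀, 0) ≤ (L' + 1) * (a₁ / (2 * (L' + 1))) := by gcongr; linarith
        _ = a₁ / 2 := by field_simp
    rw [mem_ball]
    calc dist (α z t) (x₀, 0) ≤ dist (α z t) (α (x₀, 0) t) + dist (α (x₀, 0) t) (x₀, 0) :=
          dist_triangle _ _ _
      _ < a₁ := by linarith
  have hmem : ∀ x ∈ closedBall x₀ r, ∀ v ∈ closedBall (0 : E) r,
      ((x, v) : E × E) ∈ closedBall ((x₀, 0) : E × E) r := fun x hx v hv ↦ by
    rw [← closedBall_prod_same]; exact ⟨hx, hv⟩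
  have hder : ∀ z ∈ closedBall ((x₀, 0) : E × E) r, ∀ t ∈ Icc 0 T,
      HasDerivAt (fun s ↦ (α z s).1) (α z t).2 t ∧
        HasDerivAt (fun s ↦ (α z s).2) (S (α z t)) t := fun z hz t ht ↦ by
    have h := hαd z (hstay z hz).1 t ⟨by linarith [ht.1], by linarith [ht.2]⟩
    exact ⟨h.fst, h.snd⟩
  -- the zero velocity solutions are constant
  have hconst : ∀ x ∈ closedBall x₀ r, (α (x, 0) T).1 = x := by
    intro x hx
    have hz := hmem x hx 0 (mem_closedBall_self hrpos.le)
    -- Grönwall: since `S (x, 0) = 0` along the curve, `‖V'‖ = ‖S (X, V) - S (X, 0)‖ ≤ K ‖V‖`, and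
    -- `V` starts at zero.
    have hV : ∀ t ∈ Icc 0 T, (α (x, 0) t).2 = 0 := by
      apply eq_zero_of_abs_deriv_le_mul_abs_self_of_eq_zero_right
        (f' := fun t ↦ S (α (x, 0) t)) (K := K)
      · exact fun t ht ↦ (hder _ hz t ht).2.continuousAt.continuousWithinAt
      · exact fun t ht ↦ (hder _ hz t (Ico_subset_Icc_self ht)).2.hasDerivWithinAt
      · rw [(hα _ (hstay _ hz).1).1]
      · intro t ht
        have hb := (hstay _ hz).2 t (Ico_subset_Icc_self ht)
        have hb' : ((α (x, 0) t).1, (0 : E)) ∈ ball ((x₀, 0) : E × E) a₁ := by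
          rw [← ball_prod_same] at hb ⊢
          exact ⟨hb.1, mem_ball_self ha₁⟩
        have h1 := hK.dist_le_mul _ (hball hb).1 _ (hball hb').1
        rw [(hball hb').2.2, dist_zero_right] at h1
        refine h1.trans_eq ?_
        rw [Prod.dist_eq]
        simp
    have h1 : ∀ t ∈ Icc 0 T, (α (x, 0) t).1 = (α (x, 0) 0).1 := by
      apply constant_of_has_deriv_right_zero
      · exact fun t ht ↦ (hder _ hz t ht).1.continuousAt.continuousWithinAt
      · intro t ht
        have := (hder _ hz t (Ico_subset_Icc_self ht)).1.hasDerivWithinAt (s := Ici t)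
        rwa [hV t (Ico_subset_Icc_self ht)] at this
    rw [h1 T ⟨hTpos.le, le_rfl⟩, (hα _ (hstay _ hz).1).1]
  -- The endpoint map `v ↦ X x v T` differs from `v ↦ T v` by a map with Lipschitz constant `T / 2 <
  -- T`. Integrating the bound on the velocities gives this uniformly in `x`, so the quantitative
  -- surjectivity theorem applies with uniform constants.
  have happrox : ∀ x ∈ closedBall x₀ r, ∀ v ∈ closedBall (0 : E) r, ∀ w ∈ closedBall (0 : E) r,
      ‖(α (x, v) T).1 - (α (x, w) T).1 - T • (v - w)‖ ≤ T / 2 * ‖v - w‖ := by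
    intro x hx v hv w hw
    have hzv := hmem x hx v hv
    have hzw := hmem x hx w hw
    have hα0v := (hα _ (hstay _ hzv).1).1
    have hα0w := (hα _ (hstay _ hzw).1).1
    simp only at hα0v hα0w
    have hvel : ∀ t ∈ Icc 0 T, ‖(α (x, v) t).2 - (α (x, w) t).2 - (v - w)‖ ≤ 1 / 2 * ‖v - w‖ := by
      intro t ht
      have hb := image_norm_le_of_norm_deriv_right_le_deriv_boundary
        (f := fun t ↦ (α (x, v) t).2 - (α (x, w) t).2 - (v - w))
        (f' := fun t ↦ S (α (x, v) t) - S (α (x, w) t)) (a := 0) (b := T)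
        (B := fun t ↦ K * L' * ‖v - w‖ * t) (B' := fun _ ↦ K * L' * ‖v - w‖)
        (fun t ht ↦ ((((hder _ hzv t ht).2.sub (hder _ hzw t ht).2).sub_const
          (v - w)).continuousAt.continuousWithinAt))
        (fun t ht ↦ ((((hder _ hzv t (Ico_subset_Icc_self ht)).2.sub
          (hder _ hzw t (Ico_subset_Icc_self ht)).2).sub_const (v - w)).hasDerivWithinAt))
        (by simp [hα0v, hα0w])
        (fun t ↦ by simpa using (hasDerivAt_id t).const_mul (K * L' * ‖v - w‖ : ℝ))
        (fun t ht ↦ by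
          have h1 := hK.dist_le_mul _ (hball ((hstay _ hzv).2 t (Ico_subset_Icc_self ht))).1 _
            (hball ((hstay _ hzw).2 t (Ico_subset_Icc_self ht))).1
          have h2 : dist (α (x, v) t) (α (x, w) t) ≤ L' * dist (x, v) (x, w) :=
            (hL' t ⟨by linarith [ht.1], by linarith [ht.2]⟩).dist_le_mul _ (hstay _ hzv).1 _
              (hstay _ hzw).1
          have h3 : dist ((x, v) : E × E) (x, w) = ‖v - w‖ := by
            simp [dist_eq_norm]
          rw [← dist_eq_norm]
          rw [h3] at h2
          calc dist (S (α (x, v) t)) (S (α (x, w) t)) ≤ K * dist (α (x, v) t) (α (x, w) t) := h1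
            _ ≤ K * (L' * ‖v - w‖) := by gcongr
            _ = _ := by ring)
      refine (hb ht).trans ?_
      have : (0 : ℝ) ≤ K * L' := by positivity
      calc K * L' * ‖v - w‖ * t ≤ K * L' * ‖v - w‖ * T := by gcongr; exact ht.2
        _ = (K * L' * T) * ‖v - w‖ := by ring
        _ ≤ _ := by gcongr
    have hb := image_norm_le_of_norm_deriv_right_le_deriv_boundary
        (f := fun t ↦ (α (x, v) t).1 - (α (x, w) t).1 - t • (v - w))
        (f' := fun t ↦ (α (x, v) t).2 - (α (x, w) t).2 - (v - w)) (a := 0) (b := T)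
        (B := fun t ↦ 1 / 2 * ‖v - w‖ * t) (B' := fun _ ↦ 1 / 2 * ‖v - w‖)
        (fun t ht ↦ (((hder _ hzv t ht).1.sub (hder _ hzw t ht).1).sub
          ((hasDerivAt_id t).smul_const (v - w))).continuousAt.continuousWithinAt)
        (fun t ht ↦ by
          have h := (((hder _ hzv t (Ico_subset_Icc_self ht)).1.sub
            (hder _ hzw t (Ico_subset_Icc_self ht)).1).sub
            ((hasDerivAt_id t).smul_const (v - w))).hasDerivWithinAt (s := Ici t)
          rw [one_smul] at h
          exact h)
        (by simp [hα0v, hα0w])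
        (fun t ↦ by simpa using (hasDerivAt_id t).const_mul (1 / 2 * ‖v - w‖))
        (fun t ht ↦ hvel t (Ico_subset_Icc_self ht)) (show T ∈ Icc 0 T from ⟨hTpos.le, le_rfl⟩)
    refine hb.trans_eq ?_
    ring
  set e : E ≃L[ℝ] E := ContinuousLinearEquiv.smulLeft (Units.mk0 T hTpos.ne') with he
  have hev : ∀ v, e v = T • v := fun v ↦ rfl
  have hesymm : ∀ v, e.symm v = T⁻¹ • v := fun v ↦ by
    rw [ContinuousLinearEquiv.symm_apply_eq, hev, smul_smul, mul_inv_cancel₀ hTpos.ne', one_smul]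
  let fs : (e : E →L[ℝ] E).NonlinearRightInverse :=
    { toFun := e.symm
      nnnorm := ⟨T⁻¹, (inv_pos.2 hTpos).le⟩
      bound' := fun y ↦ by
        rw [hesymm, norm_smul, Real.norm_of_nonneg (inv_pos.2 hTpos).le]; rfl
      right_inv' := fun y ↦ e.apply_symm_apply y }
  have happ : ∀ x ∈ closedBall x₀ r, ApproximatesLinearOn (fun v ↦ (α (x, v) T).1) (e : E →L[ℝ] E)
      (closedBall 0 r) ⟨T / 2, by positivity⟩ := fun x hx v hv w hw ↦ happrox x hx v hv w hw
  -- The endpoint map from `x` covers the closed ball of radius `(T - T/2) (r/2) = T r / 4` about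
  -- `x`, and two points of the `δ`-ball are less than `2 δ ≤ T r / 4` apart.
  set δ : ℝ := min r (min a₁ (T * r / 8)) with hδ
  have hδpos : 0 < δ := by positivity
  have hδr : ∀ x ∈ ball x₀ δ, x ∈ closedBall x₀ r := fun x hx ↦
    ball_subset_closedBall (ball_subset_ball (min_le_left _ _) hx)
  have hδT : δ ≤ T * r / 8 := (min_le_right _ _).trans (min_le_right _ _)
  refine ⟨δ, hδpos, r, hrpos, T, hTpos, fun x v s ↦ (α (x, v) s).1, fun x v s ↦ (α (x, v) s).2,
    ?_, fun x hx ↦ ⟨?_, ?_, ?_⟩⟩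
  · intro x hx
    have : ((x, 0) : E × E) ∈ ball ((x₀, 0) : E × E) a₁ := by
      rw [← ball_prod_same]
      exact ⟨ball_subset_ball ((min_le_right _ _).trans (min_le_left _ _)) hx, mem_ball_self ha₁⟩
    exact (hball this).2.1
  · exact ((happ x (hδr x hx)).continuousOn).mono ball_subset_closedBall
  · intro y hy
    have hsurj := (happ x (hδr x hx)).surjOn_closedBall_of_nonlinearRightInverse fs
      (ε := r / 2) (b := 0) (by positivity) (closedBall_subset_closedBall (by linarith))
    have hy' : y ∈ closedBall (α (x, 0) T).1
        ((((fs.nnnorm : ℝ))⁻¹ - ((⟨T / 2, by positivity⟩ : ℝ≥0) : ℝ)) * (r / 2)) := by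
      rw [hconst x (hδr x hx), mem_closedBall]
      have h1 : (((fs.nnnorm : ℝ))⁻¹ - ((⟨T / 2, by positivity⟩ : ℝ≥0) : ℝ)) * (r / 2) = T * r / 4 := by
        change ((T⁻¹)⁻¹ - T / 2) * (r / 2) = T * r / 4
        rw [inv_inv]; ring
      rw [h1]
      have := dist_triangle_right y x x₀
      have h2 := mem_ball.1 hx
      have h3 := mem_ball.1 hy
      linarith
    obtain ⟨v, hv, hvy⟩ := hsurj hy'
    exact ⟨v, closedBall_subset_ball (by linarith) hv, hvy⟩
  · intro v hv
    have hz := hmem x (hδr x hx) v (ball_subset_closedBall hv)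
    have h0' := (hα _ (hstay _ hz).1).1
    simp only at h0'
    refine ⟨by simp [h0'], by simp [h0'], fun s hs ↦ ?_⟩
    exact ⟨(hball ((hstay _ hz).2 s hs)).2.1, (hder _ hz s hs).1, (hder _ hz s hs).2⟩

end SecondOrderFlow

/-! ### The polynomial `ε ↦ G (v, adj (1 - ε A) v)` and its common roots. -/

section KillingPolynomial

open Matrix Module Polynomial

/-- `P` may be singular, so `P⁻¹` is not available. Taking adjugates of `g P = Pᵀ g` and multiplying
by `g` on both sides gives the claim up to the factor `det g`, which cancels. -/
theorem Matrix.isSymm_mul_adjugate {ι R : Type*} [Fintype ι] [DecidableEq ι] [Field R]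
    {g P : Matrix ι ι R} (hg : g.IsSymm) (hdet : g.det ≠ 0) (hgP : g * P = Pᵀ * g) :
    (g * P.adjugate).IsSymm := by
  have h1 : P.adjugate * g.adjugate = g.adjugate * Pᵀ.adjugate := by
    rw [← Matrix.adjugate_mul_distrib, hgP, Matrix.adjugate_mul_distrib]
  have h2 : g.det • (g * P.adjugate) = g.det • (P.adjugateᵀ * g) := by
    calc g.det • (g * P.adjugate) = g * (P.adjugate * g.adjugate) * g := by
          rw [Matrix.mul_assoc, Matrix.mul_assoc, Matrix.adjugate_mul]; simp
      _ = (g * g.adjugate) * (P.adjugateᵀ * g) := by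
          rw [h1, Matrix.adjugate_transpose]; simp only [Matrix.mul_assoc]
      _ = g.det • (P.adjugateᵀ * g) := by rw [Matrix.mul_adjugate]; simp
  rw [Matrix.IsSymm, Matrix.transpose_mul, hg.eq]
  exact (smul_right_injective _ hdet h2).symm

/-- A symmetric complex bilinear form on `ℝ^ι` whose quadratic form vanishes on a nonempty open set
of real vectors is zero. -/
theorem Matrix.IsSymm.eq_zero_of_quadratic_eq_zero {ι E : Type*} [Fintype ι] [DecidableEq ι]
    [NormedAddCommGroup E] [NormedSpace ℝ E] (b : Basis ι ℝ E) {S : Matrix ι ι ℂ} (hS : S.IsSymm)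
    {O : Set E} (hO : IsOpen O) (hne : O.Nonempty)
    (h : ∀ v ∈ O, (fun i ↦ ((b.repr v i : ℝ) : ℂ)) ⬝ᵥ (S *ᵥ fun i ↦ ((b.repr v i : ℝ) : ℂ)) = 0) :
    S = 0 := by
  set c : E → ι → ℂ := fun v i ↦ ((b.repr v i : ℝ) : ℂ) with hc
  have hadd : ∀ v w, c (v + w) = c v + c w := fun v w ↦ by ext i; simp [hc]
  have hsmul : ∀ (t : ℝ) v, c (t • v) = (t : ℂ) • c v := fun t v ↦ by ext i; simp [hc]
  have hsym : ∀ x y : ι → ℂ, x ⬝ᵥ (S *ᵥ y) = y ⬝ᵥ (S *ᵥ x) := fun x y ↦ by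
    rw [dotProduct_mulVec, dotProduct_comm, ← Matrix.mulVec_transpose, hS.eq]
  have hexp : ∀ v w, c (v + w) ⬝ᵥ (S *ᵥ c (v + w)) =
      c v ⬝ᵥ (S *ᵥ c v) + 2 * (c v ⬝ᵥ (S *ᵥ c w)) + c w ⬝ᵥ (S *ᵥ c w) := fun v w ↦ by
    rw [hadd, Matrix.mulVec_add, add_dotProduct, dotProduct_add, dotProduct_add, hsym (c w) (c v)]
    ring
  obtain ⟨v₀, hv₀⟩ := hne
  -- Second difference of the quadratic form `Q`: `Q(v₀ + t w) + Q(v₀ - t w) - 2 Q(v₀) = 2 t² Q(w)`,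
  -- with all three terms on the left zero for small `t`.
  have hall : ∀ w, c w ⬝ᵥ (S *ᵥ c w) = 0 := by
    intro w
    have hcont : Continuous fun t : ℝ ↦ v₀ + t • w := by fun_prop
    have h0 : ∀ᶠ t : ℝ in 𝓝 0, v₀ + t • w ∈ O ∧ v₀ + (-t) • w ∈ O := by
      have h1 : Filter.Tendsto (fun t : ℝ ↦ v₀ + t • w) (𝓝 0) (𝓝 v₀) := by
        simpa using hcont.tendsto 0
      have h2 : Filter.Tendsto (fun t : ℝ ↦ v₀ + (-t) • w) (𝓝 0) (𝓝 v₀) := by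
        have := (hcont.comp continuous_neg).tendsto 0
        simpa [Function.comp_def] using this
      exact (h1.eventually (hO.mem_nhds hv₀)).and (h2.eventually (hO.mem_nhds hv₀))
    obtain ⟨t, ⟨ht1, ht2⟩, ht0⟩ :=
      ((h0.filter_mono nhdsWithin_le_nhds).and self_mem_nhdsWithin : ∀ᶠ t in 𝓝[≠] (0 : ℝ), _).exists
    have e1 := h _ ht1
    have e2 := h _ ht2
    have e0 := h _ hv₀
    rw [hexp, hsmul] at e1 e2
    simp only [Matrix.mulVec_smul, dotProduct_smul, smul_dotProduct, smul_eq_mul] at e1 e2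
    rw [e0] at e1 e2
    push_cast at e2
    have ht : (t : ℂ) ≠ 0 := by exact_mod_cast ht0
    have e3 : (t : ℂ) * t * (c w ⬝ᵥ (S *ᵥ c w)) = 0 := by linear_combination (e1 + e2) / 2
    simpa [ht] using e3
  have hb : ∀ i, c (b i) = Pi.single i 1 := fun i ↦ by
    ext j
    by_cases hij : j = i
    · subst hij; simp [hc]
    · simp [hc, Ne.symm hij]
  ext i j
  have e := hexp (b i) (b j)
  rw [hall, hall, hall, hb, hb] at e
  simpa using e.symm

variable {ι E : Type*} [Fintype ι] [DecidableEq ι] [NormedAddCommGroup E] [NormedSpace ℝ E]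

/-- The polynomial `ε ↦ G (v, adj (1 - ε A) v)`, the adjugate being computed in the basis `b`. -/
noncomputable def killingPolynomial (b : Basis ι ℝ E) (G : E →L[ℝ] E →L[ℝ] ℝ) (A : E →L[ℝ] E) (v : E) : ℝ[X] :=
  (fun i ↦ C (G v (b i))) ⬝ᵥ
    ((1 - (X : ℝ[X]) • (LinearMap.toMatrix b b (A : E →ₗ[ℝ] E)).map C).adjugate *ᵥ
      fun i ↦ C (b.repr v i))

/-- Adjugates commute with ring homomorphisms. The field `K` is left free because reciprocals of
non-real eigenvalues will be inserted. -/
theorem aeval_killingPolynomial (b : Basis ι ℝ E) (G : E →L[ℝ] E →L[ℝ] ℝ) (A : E →L[ℝ] E) (v : E)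
    {K : Type*} [Field K] [Algebra ℝ K] (ε : K) :
    aeval ε (killingPolynomial b G A v) = (fun i ↦ algebraMap ℝ K (G v (b i))) ⬝ᵥ
      ((1 - ε • (LinearMap.toMatrix b b (A : E →ₗ[ℝ] E)).map (algebraMap ℝ K)).adjugate *ᵥ
        fun i ↦ algebraMap ℝ K (b.repr v i)) := by
  have hmat : (aeval ε : ℝ[X] →ₐ[ℝ] K).mapMatrix
      (1 - (X : ℝ[X]) • (LinearMap.toMatrix b b (A : E →ₗ[ℝ] E)).map C) =
      1 - ε • (LinearMap.toMatrix b b (A : E →ₗ[ℝ] E)).map (algebraMap ℝ K) := by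
    rw [map_sub, map_one]
    congr 1
    ext i j
    simpa using mul_comm _ _
  rw [killingPolynomial, ← hmat, ← AlgHom.map_adjugate, dotProduct, dotProduct, map_sum]
  refine Finset.sum_congr rfl fun i _ ↦ ?_
  rw [map_mul, aeval_C, mulVec, mulVec, dotProduct, dotProduct, map_sum]
  simp

/-- With `B = 1 - ε A` and `v = B W`, one has `adj(B) v = det(B) W`. This links the polynomial to
the expression that can be differentiated along a geodesic. -/
theorem eval_killingPolynomial (b : Basis ι ℝ E) (G : E →L[ℝ] E →L[ℝ] ℝ) (A : E →L[ℝ] E)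
    {v W : E} {ε : ℝ} (hW : W - ε • A W = v) :
    (killingPolynomial b G A v).eval ε =
      LinearMap.det ((1 - ε • A : E →L[ℝ] E) : E →ₗ[ℝ] E) * G v W := by
  rw [← coe_aeval_eq_eval, aeval_killingPolynomial]
  set B : Matrix ι ι ℝ :=
    1 - ε • (LinearMap.toMatrix b b (A : E →ₗ[ℝ] E)).map (algebraMap ℝ ℝ) with hB
  have hBm : B = LinearMap.toMatrix b b ((1 - ε • A : E →L[ℝ] E) : E →ₗ[ℝ] E) := by
    rw [ContinuousLinearMap.toLinearMap_sub, map_sub, ContinuousLinearMap.toLinearMap_smul, map_smul,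
      hB]
    congr 1
    exact (LinearMap.toMatrix_one b).symm
  have hv : (fun i ↦ algebraMap ℝ ℝ (b.repr v i)) = B *ᵥ (b.repr W) := by
    rw [hBm, LinearMap.toMatrix_mulVec_repr]
    have : ((1 - ε • A : E →L[ℝ] E) : E →ₗ[ℝ] E) W = v := by simpa using hW
    rw [this]
    rfl
  rw [hv, Matrix.mulVec_mulVec, Matrix.adjugate_mul, hBm, LinearMap.det_toMatrix, Matrix.smul_mulVec,
    Matrix.one_mulVec, dotProduct_smul, smul_eq_mul]
  congr 1
  conv_rhs => rw [← b.sum_repr W, map_sum]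
  refine Finset.sum_congr rfl fun i _ ↦ ?_
  simp [mul_comm]

/-- This makes the polynomial of a non-null vector nonzero, hence its root set finite. -/
theorem eval_zero_killingPolynomial (b : Basis ι ℝ E) (G : E →L[ℝ] E →L[ℝ] ℝ) (A : E →L[ℝ] E)
    (v : E) : (killingPolynomial b G A v).eval 0 = G v v := by
  rw [eval_killingPolynomial b G A (W := v) (by simp), zero_smul, sub_zero]
  simp

/-- If the Killing polynomials of an open set of vectors have the common root `ν`, then
`adj (1 - ν A) = 0`. -/
theorem adjugate_eq_zero_of_aeval_killingPolynomial (b : Basis ι ℝ E) {G : E →L[ℝ] E →L[ℝ] ℝ}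
    {A : E →L[ℝ] E} (hsymm : ∀ u v, G u v = G v u) (hnd : ∀ u, (∀ v, G u v = 0) → u = 0)
    (hA : ∀ u v, G (A u) v = G u (A v)) {ν : ℂ} {O : Set E} (hO : IsOpen O) (hne : O.Nonempty)
    (h : ∀ v ∈ O, aeval ν (killingPolynomial b G A v) = 0) :
    (1 - ν • (LinearMap.toMatrix b b (A : E →ₗ[ℝ] E)).map (algebraMap ℝ ℂ)).adjugate = 0 := by
  set M := LinearMap.toMatrix b b (A : E →ₗ[ℝ] E) with hM
  set g₀ : Matrix ι ι ℝ := Matrix.of fun i j ↦ G (b i) (b j) with hg₀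
  have hg₀s : g₀.IsSymm := by ext i j; exact hsymm _ _
  have hGv : ∀ v, (fun i ↦ G v (b i)) = g₀ *ᵥ (b.repr v) := fun v ↦ by
    ext i
    conv_lhs => rw [hsymm, ← b.sum_repr v, map_sum]
    refine Finset.sum_congr rfl fun j _ ↦ ?_
    simp [hg₀, mul_comm]
  have hdet₀ : g₀.det ≠ 0 := by
    intro hd
    obtain ⟨z, hz0, hz⟩ := Matrix.exists_mulVec_eq_zero_iff.mpr hd
    have hr : ((b.repr (b.equivFun.symm z) : ι →₀ ℝ) : ι → ℝ) = z := by
      rw [← Basis.equivFun_apply, LinearEquiv.apply_symm_apply]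
    have hu : b.equivFun.symm z = 0 := by
      apply hnd
      intro v
      rw [← b.sum_repr v, map_sum]
      refine Finset.sum_eq_zero fun i _ ↦ ?_
      have : G (b.equivFun.symm z) (b i) = 0 := by
        have := congrFun (hGv (b.equivFun.symm z)) i
        rw [hr, hz] at this
        exact this
      rw [map_smul, this, smul_zero]
    exact hz0 ((LinearEquiv.map_eq_zero_iff _).mp hu)
  have hgM₀ : g₀ * M = Mᵀ * g₀ := by
    ext i j
    have h1 : A (b j) = ∑ k, M k j • b k := by
      conv_lhs => rw [← b.sum_repr (A (b j))]
      simp [hM, LinearMap.toMatrix_apply]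
    have h2 : A (b i) = ∑ k, M k i • b k := by
      conv_lhs => rw [← b.sum_repr (A (b i))]
      simp [hM, LinearMap.toMatrix_apply]
    have h3 := hA (b i) (b j)
    rw [h1, h2] at h3
    simp only [map_sum, map_smul, FunLike.coe_sum, Finset.sum_apply,
      FunLike.coe_smul, Pi.smul_apply, smul_eq_mul] at h3
    simp only [Matrix.mul_apply, Matrix.transpose_apply, hg₀, Matrix.of_apply]
    rw [h3]
    exact Finset.sum_congr rfl fun k _ ↦ mul_comm _ _
  set φ : ℝ →+* ℂ := algebraMap ℝ ℂ with hφ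
  set P := 1 - ν • M.map φ with hP
  have hgP : g₀.map φ * P = Pᵀ * g₀.map φ := by
    have h1 : g₀.map φ * M.map φ = (M.map φ)ᵀ * g₀.map φ := by
      rw [← Matrix.map_mul, hgM₀, Matrix.map_mul, Matrix.transpose_map]
    rw [hP, Matrix.mul_sub, Matrix.transpose_sub, Matrix.sub_mul, Matrix.transpose_smul,
      Matrix.mul_smul, Matrix.smul_mul, h1]
    simp
  have hdet : (g₀.map φ).det ≠ 0 := by
    have : (g₀.map φ).det = φ g₀.det := (RingHom.map_det φ g₀).symm
    rw [this]
    exact (map_ne_zero φ).mpr hdet₀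
  have hgs : (g₀.map φ).IsSymm := hg₀s.map φ
  have hS := Matrix.isSymm_mul_adjugate hgs hdet hgP
  have hzero : g₀.map φ * P.adjugate = 0 := by
    -- Selfadjointness of `A` makes `g₀ adj(P)` symmetric, so its quadratic form on an open set of
    -- real vectors determines it.
    apply hS.eq_zero_of_quadratic_eq_zero b hO hne
    intro v hv
    have h1 := h v hv
    rw [aeval_killingPolynomial] at h1
    rw [← h1, ← Matrix.mulVec_mulVec, Matrix.dotProduct_mulVec, ← Matrix.mulVec_transpose, hgs.eq]
    congr 1
    ext i
    have := congrArg φ (congrFun (hGv v) i)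
    rw [RingHom.map_mulVec] at this
    exact this.symm
  have hunit : IsUnit (g₀.map φ).det := isUnit_iff_ne_zero.mpr hdet
  calc P.adjugate = (g₀.map φ)⁻¹ * (g₀.map φ * P.adjugate) := by
        rw [← Matrix.mul_assoc, Matrix.nonsing_inv_mul _ hunit, Matrix.one_mul]
    _ = 0 := by rw [hzero, Matrix.mul_zero]

end KillingPolynomial

/-! ### Metrics and compatible tensors on open sets of a normed space. -/

namespace GeodEquiv

section Coordinates

open Module

variable {E : Type*} [NormedAddCommGroup E] [NormedSpace ℝ E]



theorem isInvertible_of_nondegenerate [FiniteDimensional ℝ E] {B : E →L[ℝ] E →L[ℝ] ℝ} (h : ∀ u, (∀ v, B u v = 0) → u = 0) :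
    B.IsInvertible := by
  have hinj : Function.Injective (B : E →ₗ[ℝ] E →L[ℝ] ℝ) := by
    rw [← LinearMap.ker_eq_bot, LinearMap.ker_eq_bot']
    intro u hu
    exact h u fun v ↦ by
      have := congrArg (fun f : E →L[ℝ] ℝ ↦ f v) hu
      simpa using this
  have hfin : finrank ℝ E = finrank ℝ (E →L[ℝ] ℝ) := by
    rw [← Subspace.dual_finrank_eq (K := ℝ) (V := E)]
    exact (LinearMap.toContinuousLinearMap (𝕜 := ℝ) (E := E) (F' := ℝ)).finrank_eq
  exact ⟨(LinearEquiv.ofInjectiveOfFinrankEq _ hinj hfin).toContinuousLinearEquiv, by ext; rfl⟩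

theorem hasDerivAt_comp_of_differentiableAt {F : Type*} [NormedAddCommGroup F] [NormedSpace ℝ F]
    {f : E → F} {X : ℝ → E} {v : E} {s : ℝ} (hX : HasDerivAt X v s)
    (h : DifferentiableAt ℝ f (X s)) : HasDerivAt (fun t ↦ f (X t)) (fderiv ℝ f (X s) v) s :=
  h.hasFDerivAt.comp_hasDerivAt s hX

variable {G : E → E →L[ℝ] E →L[ℝ] ℝ} {A : E → E →L[ℝ] E} {y : E}

/-- The Christoffel symbols of a metric on an open subset of a normed space. -/
noncomputable def christoffel (G : E → E →L[ℝ] E →L[ℝ] ℝ) (y u v : E) : E :=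
  ContinuousLinearMap.inverse (G y)
    ((1 / 2 : ℝ) • (fderiv ℝ G y u v + fderiv ℝ G y v u - ((fderiv ℝ G y).flip u).flip v))

/-- The covariant derivative `(∇_u A) (v)` of an endomorphism field. -/
noncomputable def covDerivTensor (G : E → E →L[ℝ] E →L[ℝ] ℝ) (A : E → E →L[ℝ] E) (y u v : E) : E :=
  fderiv ℝ A y u v + christoffel G y u (A y v) - A y (christoffel G y u v)

/-- With the index lowered, the inverse of the metric disappears; nondegeneracy recovers the symbols
from this formula in `christoffel_unique`. -/
theorem christoffel_spec (hG : (G y).IsInvertible) (u v w : E) :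
    G y (christoffel G y u v) w =
      1 / 2 * (fderiv ℝ G y u v w + fderiv ℝ G y v u w - fderiv ℝ G y w u v) := by
  rw [christoffel, hG.self_apply_inverse]
  simp

theorem christoffel_unique [FiniteDimensional ℝ E] (hnd : ∀ u, (∀ v, G y u v = 0) → u = 0) {u v z : E}
    (h : ∀ w, G y z w =
      1 / 2 * (fderiv ℝ G y u v w + fderiv ℝ G y v u w - fderiv ℝ G y w u v)) :
    christoffel G y u v = z := by
  rw [← sub_eq_zero]
  apply hnd
  intro w
  rw [map_sub, sub_apply,
    christoffel_spec (isInvertible_of_nondegenerate hnd), h, sub_self]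

theorem fderiv_symm_apply (hd : DifferentiableAt ℝ G y)
    (hs : ∀ᶠ z in 𝓝 y, ∀ u v, G z u v = G z v u) (u v w : E) :
    fderiv ℝ G y u v w = fderiv ℝ G y u w v := by
  have h1 : ∀ v w, HasFDerivAt (fun z ↦ G z v w) (((fderiv ℝ G y).flip v).flip w) y := fun v w ↦ by
    have h2 := (hd.hasFDerivAt.clm_apply (hasFDerivAt_const v y)).clm_apply (hasFDerivAt_const w y)
    convert! h2 using 1
    ext u
    simp
  have h2 := (h1 v w).congr_of_eventuallyEq (hs.mono fun z hz ↦ hz w v)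
  exact DFunLike.congr_fun (h2.unique (h1 w v)) u

/-- The coordinate expressions `G`, `A` of a metric and of a tensor compatible with it, on an open
set; the main equation is paired with a third vector. -/
structure CompatibleCoordOn (G : E → E →L[ℝ] E →L[ℝ] ℝ) (A : E → E →L[ℝ] E) (Ω : Set E) :
    Prop where
  isOpen : IsOpen Ω
  contDiffOn_metric : ContDiffOn ℝ ∞ G Ω
  contDiffOn_tensor : ContDiffOn ℝ ∞ A Ω
  symm : ∀ y ∈ Ω, ∀ u v, G y u v = G y v u
  nondegenerate : ∀ y ∈ Ω, ∀ u, (∀ v, G y u v = 0) → u = 0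
  selfadjoint : ∀ y ∈ Ω, ∀ u v, G y (A y u) v = G y u (A y v)
  main : ∀ y ∈ Ω, ∀ u v w, G y (covDerivTensor G A y u v) w =
    1 / 2 * (LinearMap.trace ℝ E (fderiv ℝ A y v) * G y u w +
      G y u v * LinearMap.trace ℝ E (fderiv ℝ A y w))

namespace CompatibleCoordOn

variable {Ω : Set E}

theorem differentiableAt_metric (h : CompatibleCoordOn G A Ω) (hy : y ∈ Ω) : DifferentiableAt ℝ G y :=
  (h.contDiffOn_metric.contDiffAt (h.isOpen.mem_nhds hy)).differentiableAt (by simp)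

theorem differentiableAt_tensor (h : CompatibleCoordOn G A Ω) (hy : y ∈ Ω) : DifferentiableAt ℝ A y :=
  (h.contDiffOn_tensor.contDiffAt (h.isOpen.mem_nhds hy)).differentiableAt (by simp)

theorem isInvertible [FiniteDimensional ℝ E] (h : CompatibleCoordOn G A Ω) (hy : y ∈ Ω) : (G y).IsInvertible :=
  isInvertible_of_nondegenerate (h.nondegenerate y hy)

theorem fderiv_symm (h : CompatibleCoordOn G A Ω) (hy : y ∈ Ω) (u v w : E) : fderiv ℝ G y u v w = fderiv ℝ G y u w v :=
  fderiv_symm_apply (h.differentiableAt_metric hy)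
    (Filter.eventually_of_mem (h.isOpen.mem_nhds hy) h.symm) u v w

/-- The Levi-Civita connection is metric. -/
theorem fderiv_metric [FiniteDimensional ℝ E] (h : CompatibleCoordOn G A Ω) (hy : y ∈ Ω) (u v w : E) :
    fderiv ℝ G y u v w = G y (christoffel G y u v) w + G y v (christoffel G y u w) := by
  rw [h.symm y hy v, christoffel_spec (h.isInvertible hy),
    christoffel_spec (h.isInvertible hy), h.fderiv_symm hy u w v, h.fderiv_symm hy w u v,
    h.fderiv_symm hy v u w]
  ring

end CompatibleCoordOn
end Coordinates
end GeodEquiv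

/-! ### The first integral of the geodesic flow. -/

namespace GeodEquiv

section FirstIntegral

open Module

theorem mul_comm_of_one_sub_smul_mul {E : Type*} [NormedAddCommGroup E] [NormedSpace ℝ E]
    {A C : E →L[ℝ] E} {ε : ℝ} (hC : (1 - ε • A) * C = 1) (hC' : C * (1 - ε • A) = 1) :
    C * A = A * C := by
  by_cases hε : ε = 0
  · subst hε
    have : C = 1 := by simpa using hC
    rw [this, one_mul, mul_one]
  · have h2 := hC.trans hC'.symm
    rw [sub_mul, mul_sub, one_mul, mul_one, sub_right_inj, smul_mul_assoc, mul_smul_comm] at h2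
    exact (smul_right_injective _ hε h2).symm

variable {E : Type*} [NormedAddCommGroup E] [NormedSpace ℝ E]
  {G : E → E →L[ℝ] E →L[ℝ] ℝ} {A : E → E →L[ℝ] E}
  {Ω : Set E} {y : E}

/-- The linear map `v ↦ Γ (u, v)`. -/
noncomputable def christoffelMap (G : E → E →L[ℝ] E →L[ℝ] ℝ) (y u : E) :
    E →ₗ[ℝ] E where
  toFun v := christoffel G y u v
  map_add' v w := by
    rw [christoffel, christoffel, christoffel, ← map_add]
    congr 1
    ext z
    simp
    ring
  map_smul' c v := by
    rw [christoffel, christoffel, RingHom.id_apply, ← map_smul]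
    congr 1
    ext z
    simp
    ring

theorem christoffelMap_apply (y u v : E) :
    christoffelMap G y u v = christoffel G y u v := rfl

theorem fderiv_tensor_apply (y u v : E) :
    fderiv ℝ A y u v = covDerivTensor G A y u v - christoffel G y u (A y v) +
      A y (christoffel G y u v) := by
  rw [covDerivTensor]; abel

namespace CompatibleCoordOn

variable [FiniteDimensional ℝ E]

/-- `tr ((1 - ε A)⁻¹ ∂_V A) = tr (∂_W A)` for `(1 - ε A) W = V`. -/
theorem trace_inverse_comp_fderiv (h : CompatibleCoordOn G A Ω) (hy : y ∈ Ω) {ε : ℝ}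
    {C : E →L[ℝ] E} (hC : (1 - ε • A y) * C = 1) (hC' : C * (1 - ε • A y) = 1) (V : E) :
    LinearMap.trace ℝ E ((C ∘L fderiv ℝ A y V : E →L[ℝ] E) : E →ₗ[ℝ] E) =
      LinearMap.trace ℝ E (fderiv ℝ A y (C V)) := by
  set θ : E →ₗ[ℝ] ℝ := LinearMap.trace ℝ E ∘ₗ
    ContinuousLinearMap.coeLM ℝ ∘ₗ (fderiv ℝ A y : E →ₗ[ℝ] E →L[ℝ] E) with hθ
  have hθa : ∀ v, LinearMap.trace ℝ E (fderiv ℝ A y v) = θ v := fun v ↦ rfl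
  set t : E := (G y).inverse θ.toContinuousLinearMap with ht
  have htv : ∀ v, G y t v = θ v := fun v ↦ by
    rw [ht, (h.isInvertible hy).self_apply_inverse]; rfl
  have hBC : ∀ v, C v - ε • A y (C v) = v := fun v ↦ by
    simpa using DFunLike.congr_fun hC v
  -- The compatibility equation with its index raised: `θ = d tr A`, and `t` is the gradient of `tr
  -- A`.
  have hcov : ∀ v, covDerivTensor G A y V v = (1 / 2 : ℝ) • (θ v • V + G y V v • t) := by
    intro v
    rw [← sub_eq_zero]
    apply h.nondegenerate y hy
    intro w
    rw [map_sub, sub_apply, h.main y hy]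
    simp [htv, hθa]
    ring
  set Γ := christoffelMap G y V with hΓ
  set a : E →ₗ[ℝ] E := (fderiv ℝ A y V : E →ₗ[ℝ] E) with ha
  set B : E →ₗ[ℝ] E := (A y : E →ₗ[ℝ] E) with hB
  set C' : E →ₗ[ℝ] E := (C : E →ₗ[ℝ] E) with hCl
  have haeq : a = (1 / 2 : ℝ) • (θ.smulRight V + (G y V : E →ₗ[ℝ] ℝ).smulRight t) - Γ * B +
      B * Γ := by
    ext1 v
    change fderiv ℝ A y V v = (1 / 2 : ℝ) • (θ v • V + G y V v • t) -
      christoffel G y V (A y v) + A y (christoffel G y V v)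
    rw [← hcov, fderiv_tensor_apply (G := G)]
  have hcomm : C' * B = B * C' :=
    congrArg ContinuousLinearMap.toLinearMap (mul_comm_of_one_sub_smul_mul hC hC')
  -- `C` commutes with `A`, so the commutator of `Γ` and `A` drops out of the trace and only the two
  -- rank-one terms of `∇_V A` remain.
  have htr : LinearMap.trace ℝ E (C' * (Γ * B)) = LinearMap.trace ℝ E (C' * (B * Γ)) := by
    rw [← mul_assoc, LinearMap.trace_mul_comm, ← mul_assoc, ← hcomm, mul_assoc]
  have hsm1 : C' * θ.smulRight V = θ.smulRight (C V) := by
    ext1 v; simp [hCl]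
  have hsm2 : C' * (G y V : E →ₗ[ℝ] ℝ).smulRight t =
      (G y V : E →ₗ[ℝ] ℝ).smulRight (C t) := by
    ext1 v; simp [hCl]
  -- `C` is selfadjoint, so the two rank-one terms have equal traces, which absorbs the factor
  -- `1/2`.
  have hGC : G y V (C t) = θ (C V) := by
    have h1 : G y (C V - ε • A y (C V)) (C t) = G y (C V) (C t - ε • A y (C t)) := by
      simp [h.selfadjoint y hy]
    rw [hBC, hBC] at h1
    rw [h1, h.symm y hy, htv]
  rw [hθa]
  change LinearMap.trace ℝ E (C' * a) = _
  rw [haeq, mul_add, mul_sub, map_add, map_sub, htr, sub_add_cancel, mul_smul_comm, mul_add, hsm1,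
    hsm2, map_smul, map_add, LinearMap.trace_smulRight, LinearMap.trace_smulRight]
  change (1 / 2 : ℝ) * (θ (C V) + G y V (C t)) = _
  rw [hGC]
  ring

/-- `det (1 - ε A) G ((1 - ε A)⁻¹ V, V)` is a first integral of the geodesic flow. -/
theorem hasDerivAt_firstIntegral (h : CompatibleCoordOn G A Ω) {X V : ℝ → E} {s ε : ℝ}
    (hs : X s ∈ Ω) (hX : HasDerivAt X (V s) s)
    (hV : HasDerivAt V (-christoffel G (X s) (V s) (V s)) s)
    (hu : IsUnit (1 - ε • A (X s))) :
    HasDerivAt (fun t ↦ LinearMap.det ((1 - ε • A (X t) : E →L[ℝ] E) : E →ₗ[ℝ] E) *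
      G (X t) (V t) (Ring.inverse (1 - ε • A (X t)) (V t))) 0 s := by
  set x := X s with hx
  set v := V s with hv
  set a := fderiv ℝ A x v with ha
  set C := Ring.inverse (1 - ε • A x) with hC
  set W := C v with hW
  have hBC : (1 - ε • A x) * C = 1 := Ring.mul_inverse_cancel _ hu
  have hCB : C * (1 - ε • A x) = 1 := Ring.inverse_mul_cancel _ hu
  have hA : HasDerivAt (fun t ↦ A (X t)) a s := 
    (h.differentiableAt_tensor (y := X s) hs).hasFDerivAt.comp_hasDerivAt s hX
  have hG : HasDerivAt (fun t ↦ G (X t)) (fderiv ℝ G x v) s :=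
    hasDerivAt_comp_of_differentiableAt (f := G) hX (h.differentiableAt_metric hs)
  have hB : HasDerivAt (fun t ↦ 1 - ε • A (X t)) (-(ε • a)) s := by
    simpa using (hA.const_smul ε).const_sub 1
  have hdet : HasDerivAt (fun t ↦
      LinearMap.det ((1 - ε • A (X t) : E →L[ℝ] E) : E →ₗ[ℝ] E))
      (LinearMap.det ((1 - ε • A x : E →L[ℝ] E) : E →ₗ[ℝ] E) *
        (-ε * LinearMap.trace ℝ E (fderiv ℝ A x W))) s := by
    have h1 := (contDiff_linearMap_det.differentiable (n := 1) one_ne_zero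
      (1 - ε • A x)).hasFDerivAt.comp_hasDerivAt s hB
    rw [fderiv_linearMap_det (T' := C) hBC] at h1
    convert! h1 using 2
    rw [← h.trace_inverse_comp_fderiv hs hBC hCB, ← ha]
    have : C ∘L (-(ε • a)) = (-ε) • (C ∘L a) := by ext1 z; simp
    rw [this, ContinuousLinearMap.toLinearMap_smul, map_smul, smul_eq_mul]
  have hWd : DifferentiableAt ℝ (fun t ↦ Ring.inverse (1 - ε • A (X t)) (V t)) s :=
    (hB.differentiableAt.inverse hu).clm_apply hV.differentiableAt
  set W' := deriv (fun t ↦ Ring.inverse (1 - ε • A (X t)) (V t)) s with hW'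
  have hWd' := hWd.hasDerivAt
  have hev : ∀ᶠ t in 𝓝 s, (1 - ε • A (X t)) (Ring.inverse (1 - ε • A (X t)) (V t)) = V t := by
    have h1 : ∀ᶠ t in 𝓝 s, IsUnit (1 - ε • A (X t)) :=
      hB.continuousAt.eventually (Units.isOpen.mem_nhds hu)
    filter_upwards [h1] with t ht
    exact DFunLike.congr_fun (Ring.mul_inverse_cancel _ ht) (V t)
  -- Differentiating `(1 - ε A) W = V` along the geodesic.
  have hWeq : W' - ε • A x W' = -christoffel G x v v + ε • a W := by
    have h1 := ((hB.clm_apply hWd').congr_of_eventuallyEq (hev.mono fun t ht ↦ ht.symm)).unique hV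
    simp only [sub_apply, neg_apply, smul_apply, one_apply_eq_self] at h1
    rw [← h1]
    abel
  have hWv : W - ε • A x W = v := by simpa using DFunLike.congr_fun hBC v
  have hAW : ε • A x W = W - v := by
    have h1 := sub_sub_cancel W (ε • A x W)
    rw [hWv] at h1
    exact h1.symm
  have hI := (hG.clm_apply hV).clm_apply hWd'
  have hf := hdet.mul hI
  convert! hf using 1
  -- The left side is the derivative of `G(V, W)`. The Christoffel terms cancel after replacing `ε A
  -- W` by `W - v`. What remains is `ε G((∇_v A) W, W) = ε θ(W) G(v, W)`, with `θ = d tr A`, and it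
  -- cancels against the logarithmic derivative `-ε θ(W)` of the determinant.
  have key : fderiv ℝ G x v v W + G x (-christoffel G x v v) W + G x v W' =
      ε * LinearMap.trace ℝ E (fderiv ℝ A x W) * G x v W := by
    have e1 : G x v W' = G x W (-christoffel G x v v + ε • a W) := by
      rw [← hWeq]
      nth_rewrite 1 [← hWv]
      simp [h.selfadjoint x hs]
    have e2 : G x W (a W) = LinearMap.trace ℝ E (fderiv ℝ A x W) * G x v W -
        G x W (christoffel G x v (A x W)) + G x W (A x (christoffel G x v W)) := by
      rw [ha, fderiv_tensor_apply (G := G), map_add, map_sub, h.symm x hs W (covDerivTensor _ _ _ _ _),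
        h.main x hs]
      ring
    have e3 : ε • christoffel G x v (A x W) =
        christoffel G x v W - christoffel G x v v := by
      rw [← christoffelMap_apply, ← christoffelMap_apply, ← christoffelMap_apply, ← map_smul,
        ← map_sub]
      rw [hAW]
    have e3' := congrArg (G x W) e3
    have e4 : ε * G x W (A x (christoffel G x v W)) =
        G x W (christoffel G x v W) - G x v (christoffel G x v W) := by
      rw [← h.selfadjoint x hs]
      have := congrArg (fun z ↦ G x z (christoffel G x v W)) hAW
      simpa using this
    rw [h.fderiv_metric hs, e1, map_add, map_smul, e2, map_neg, map_neg]
    simp only [map_smul, map_sub, smul_eq_mul, neg_apply] at e3' ⊢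
    linear_combination e4 - e3'
  change 0 = LinearMap.det ((1 - ε • A x : E →L[ℝ] E) : E →ₗ[ℝ] E) *
    (-ε * LinearMap.trace ℝ E (fderiv ℝ A x W)) * G x v W +
    LinearMap.det ((1 - ε • A x : E →L[ℝ] E) : E →ₗ[ℝ] E) *
      (fderiv ℝ G x v v W + G x (-christoffel G x v v) W + G x v W')
  rw [key]
  ring

end CompatibleCoordOn
end FirstIntegral
end GeodEquiv

/-! ### Common roots along geodesics: constancy and unique continuation. -/

namespace GeodEquiv

section GeodesicConsequences

open Module Metric Set Polynomial

theorem contDiffAt_of_forall_apply {D E F : Type*} [NormedAddCommGroup D] [NormedSpace ℝ D]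
    [NormedAddCommGroup E] [NormedSpace ℝ E] [FiniteDimensional ℝ E] [NormedAddCommGroup F]
    [NormedSpace ℝ F] {k : WithTop ℕ∞} {f : D → E →L[ℝ] F} {x : D}
    (h : ∀ y, ContDiffAt ℝ k (fun z ↦ f z y) x) : ContDiffAt ℝ k f x := by
  let e₁ := ContinuousLinearEquiv.ofFinrankEq (𝕜 := ℝ) (E := E) (F := Fin (finrank ℝ E) → ℝ)
    (finrank_fin_fun ℝ).symm
  let e₂ := (e₁.arrowCongr (1 : F ≃L[ℝ] F)).trans (ContinuousLinearEquiv.piRing (Fin (finrank ℝ E)))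
  rw [← Function.id_comp f, ← e₂.symm_comp_self]
  exact e₂.symm.contDiff.contDiffAt.comp x (contDiffAt_pi.mpr fun i ↦ h _)

theorem contDiffAt_fderiv_apply {P E F : Type*} [NormedAddCommGroup P] [NormedSpace ℝ P]
    [NormedAddCommGroup E] [NormedSpace ℝ E] [NormedAddCommGroup F] [NormedSpace ℝ F] {f : E → F}
    {x u : P → E} {p : P} (hf : ContDiffAt ℝ ∞ f (x p)) (hx : ContDiffAt ℝ 1 x p)
    (hu : ContDiffAt ℝ 1 u p) : ContDiffAt ℝ 1 (fun q ↦ fderiv ℝ f (x q) (u q)) p :=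
  (ContDiffAt.comp p (hf.fderiv_right (m := 1) (by norm_cast)) hx).clm_apply hu

variable {E : Type*} [NormedAddCommGroup E] [NormedSpace ℝ E]
  {G : E → E →L[ℝ] E →L[ℝ] ℝ} {A : E → E →L[ℝ] E} {Ω : Set E}
  {ι : Type*} [Fintype ι] [DecidableEq ι] (b : Basis ι ℝ E)

theorem aeval_killingPolynomial_eq_zero {B : E →L[ℝ] E →L[ℝ] ℝ} {L : E →L[ℝ] E} {ν : ℂ}
    (h : (1 - ν • (LinearMap.toMatrix b b (L : E →ₗ[ℝ] E)).map (algebraMap ℝ ℂ)).adjugate = 0)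
    (v : E) : aeval ν (killingPolynomial b B L v) = 0 := by
  rw [aeval_killingPolynomial, h, Matrix.zero_mulVec, dotProduct_zero]

namespace CompatibleCoordOn

variable [FiniteDimensional ℝ E]

/-- The polynomial `killingPolynomial` is a first integral of the geodesic flow. -/
theorem killingPolynomial_eq (h : CompatibleCoordOn G A Ω) {X V : ℝ → E} {T : ℝ}
    (hX : ∀ s ∈ Icc 0 T, X s ∈ Ω) (hX' : ∀ s ∈ Icc 0 T, HasDerivAt X (V s) s)
    (hV : ∀ s ∈ Icc 0 T, HasDerivAt V (-christoffel G (X s) (V s) (V s)) s) :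
    ∀ s ∈ Icc 0 T, killingPolynomial b (G (X s)) (A (X s)) (V s) =
      killingPolynomial b (G (X 0)) (A (X 0)) (V 0) := by
  intro s hs
  have hT : (0 : ℝ) ∈ Icc 0 T := ⟨le_rfl, hs.1.trans hs.2⟩
  have hcont : ContinuousOn (fun t ↦ A (X t)) (Icc 0 T) := fun t ht ↦
    ((h.differentiableAt_tensor (hX t ht)).continuousAt.comp (f := X)
      (hX' t ht).continuousAt).continuousWithinAt
  obtain ⟨c, hc⟩ := isCompact_Icc.exists_bound_of_continuousOn hcont
  have hc0 : 0 ≤ c := (norm_nonneg _).trans (hc 0 hT)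
  apply Polynomial.eq_of_infinite_eval_eq
  -- `c` bounds `‖A‖` along the arc, so for these `ε` the operator `1 - ε A` is invertible on all of
  -- it; infinitely many `ε` determine the polynomial.
  refine (Ioo_infinite (show (0 : ℝ) < 1 / (c + 1) by positivity)).mono fun ε hε ↦ ?_
  have : CompleteSpace E := FiniteDimensional.complete ℝ E
  have hu : ∀ t ∈ Icc 0 T, IsUnit (1 - ε • A (X t)) := fun t ht ↦ by
    apply isUnit_one_sub_of_norm_lt_one
    rw [norm_smul, Real.norm_of_nonneg hε.1.le]
    calc ε * ‖A (X t)‖ ≤ ε * c := by gcongr; exacts [hε.1.le, hc t ht]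
      _ ≤ ε * (c + 1) := by nlinarith [hε.1]
      _ < 1 := (lt_div_iff₀ (by positivity)).mp hε.2
  have heval : ∀ t ∈ Icc 0 T, (killingPolynomial b (G (X t)) (A (X t)) (V t)).eval ε =
      LinearMap.det ((1 - ε • A (X t) : E →L[ℝ] E) : E →ₗ[ℝ] E) *
        G (X t) (V t) (Ring.inverse (1 - ε • A (X t)) (V t)) := fun t ht ↦ by
    apply eval_killingPolynomial
    simpa using DFunLike.congr_fun (Ring.mul_inverse_cancel _ (hu t ht)) (V t)
  have hconst := constant_of_has_deriv_right_zero (a := 0) (b := T)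
    (f := fun t ↦ LinearMap.det ((1 - ε • A (X t) : E →L[ℝ] E) : E →ₗ[ℝ] E) *
        G (X t) (V t) (Ring.inverse (1 - ε • A (X t)) (V t)))
    (fun t ht ↦ (h.hasDerivAt_firstIntegral (hX t ht) (hX' t ht) (hV t ht)
      (hu t ht)).continuousAt.continuousWithinAt)
    (fun t ht ↦ (h.hasDerivAt_firstIntegral (hX t (Ico_subset_Icc_self ht))
      (hX' t (Ico_subset_Icc_self ht)) (hV t (Ico_subset_Icc_self ht))
      (hu t (Ico_subset_Icc_self ht))).hasDerivWithinAt)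
  rw [mem_ofPred_eq, heval s hs, heval 0 hT]
  exact hconst s hs

theorem contDiffAt_spray (h : CompatibleCoordOn G A Ω) {x₀ : E} (hx₀ : x₀ ∈ Ω) :
    ContDiffAt ℝ 1 (fun p : E × E ↦ -christoffel G p.1 p.2 p.2) (x₀, 0) := by
  have : CompleteSpace E := FiniteDimensional.complete ℝ E
  have hG : ContDiffAt ℝ ∞ G x₀ := h.contDiffOn_metric.contDiffAt (h.isOpen.mem_nhds hx₀)
  have hfst : ContDiffAt ℝ 1 (Prod.fst : E × E → E) (x₀, 0) := contDiffAt_fst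
  have hinv : ContDiffAt ℝ 1 (fun p : E × E ↦ ContinuousLinearMap.inverse (G p.1)) (x₀, 0) := by
    have h1 : ContDiffAt ℝ 1 ContinuousLinearMap.inverse (G x₀) :=
      (h.isInvertible hx₀).contDiffAt_map_inverse
    have h2 : ContDiffAt ℝ 1 (fun p : E × E ↦ G p.1) (x₀, 0) :=
      ContDiffAt.comp (g := G) (x₀, 0) (hG.of_le (by simp)) hfst
    exact ContDiffAt.comp (x₀, 0) h1 h2
  have hD : ∀ {u v w : E × E → E}, ContDiffAt ℝ 1 u (x₀, 0) → ContDiffAt ℝ 1 v (x₀, 0) →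
      ContDiffAt ℝ 1 w (x₀, 0) →
      ContDiffAt ℝ 1 (fun p ↦ fderiv ℝ G p.1 (u p) (v p) (w p)) (x₀, 0) := fun hu hv hw ↦
    ((contDiffAt_fderiv_apply (f := G) (x := Prod.fst) hG hfst hu).clm_apply hv).clm_apply hw
  have hsnd : ContDiffAt ℝ 1 (Prod.snd : E × E → E) (x₀, 0) := contDiffAt_snd
  have hlow : ContDiffAt ℝ 1 (fun p : E × E ↦ (1 / 2 : ℝ) • (fderiv ℝ G p.1 p.2 p.2 +
      fderiv ℝ G p.1 p.2 p.2 - ((fderiv ℝ G p.1).flip p.2).flip p.2)) (x₀, 0) := by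
    refine contDiffAt_of_forall_apply fun w ↦ ?_
    have hw : ContDiffAt ℝ 1 (fun _ : E × E ↦ w) (x₀, 0) := contDiffAt_const
    exact (((hD hsnd hsnd hw).add (hD hsnd hsnd hw)).sub (hD hw hsnd hsnd)).const_smul
      (1 / 2 : ℝ)
  exact (hinv.clm_apply hlow).neg

/-- Around every point there is a ball any two points of which are joined by a geodesic; moreover
`killingPolynomial` is constant along these geodesics. -/
theorem exists_geodesic_ball (h : CompatibleCoordOn G A Ω) {x₀ : E} (hx₀ : x₀ ∈ Ω) {O : Set E}
    (hO : O ∈ 𝓝 x₀) :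
    ∃ δ > 0, ∃ r > 0, ∃ T > 0, ∃ X V : E → E → ℝ → E, ball x₀ δ ⊆ Ω ∧ ∀ x ∈ ball x₀ δ,
      ContinuousOn (fun v ↦ X x v T) (ball 0 r) ∧
      ball x₀ δ ⊆ (fun v ↦ X x v T) '' ball 0 r ∧
      ∀ v ∈ ball (0 : E) r, X x v 0 = x ∧ ContinuousOn (X x v) (Icc 0 T) ∧
        ∀ s ∈ Icc 0 T, X x v s ∈ O ∧
          killingPolynomial b (G (X x v s)) (A (X x v s)) (V x v s) =
            killingPolynomial b (G x) (A x) v := by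
  have : CompleteSpace E := FiniteDimensional.complete ℝ E
  obtain ⟨δ, hδ, r, hr, T, hT, X, V, hsub, hflow⟩ := exists_secondOrder_flow
    (h.contDiffAt_spray hx₀) (Filter.Eventually.of_forall fun x ↦ by
      have : christoffel G x 0 0 = 0 := by
        rw [← christoffelMap_apply, map_zero]
      simp [this]) (Filter.inter_mem hO (h.isOpen.mem_nhds hx₀))
  refine ⟨δ, hδ, r, hr, T, hT, X, V, hsub.trans inter_subset_right, fun x hx ↦
    ⟨(hflow x hx).1, (hflow x hx).2.1, fun v hv ↦ ?_⟩⟩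
  obtain ⟨h1, h2, h3⟩ := (hflow x hx).2.2 v hv
  refine ⟨h1, fun s hs ↦ (h3 s hs).2.1.continuousAt.continuousWithinAt, fun s hs ↦
    ⟨(h3 s hs).1.1, ?_⟩⟩
  have h4 := h.killingPolynomial_eq b (fun s hs ↦ (h3 s hs).1.2) (fun s hs ↦ (h3 s hs).2.1)
    (fun s hs ↦ (h3 s hs).2.2) s hs
  rwa [h1, h2] at h4

/-- A continuous function of common roots of the Killing polynomials is locally constant. -/
theorem eventually_eq_of_aeval_killingPolynomial (h : CompatibleCoordOn G A Ω) {x₀ : E}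
    (hx₀ : x₀ ∈ Ω) {O : Set E} (hO : O ∈ 𝓝 x₀) {ν : E → ℂ} (hν : ContinuousOn ν O)
    (hroot : ∀ y ∈ O, ∀ v, aeval (ν y) (killingPolynomial b (G y) (A y) v) = 0) :
    ∀ᶠ y in 𝓝 x₀, ν y = ν x₀ := by
  obtain ⟨δ, hδ, r, hr, T, hT, X, V, hsub, hflow⟩ := h.exists_geodesic_ball b hx₀ hO
  have hTm : T ∈ Icc 0 T := ⟨hT.le, le_rfl⟩
  have h0m : (0 : ℝ) ∈ Icc 0 T := ⟨le_rfl, hT.le⟩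
  obtain ⟨hc, hsurj, hgeo⟩ := hflow x₀ (mem_ball_self hδ)
  rcases isEmpty_or_nonempty ι with hι | hι
  · have : Subsingleton E := b.equivFun.toEquiv.subsingleton
    exact Filter.Eventually.of_forall fun y ↦ by rw [Subsingleton.elim y x₀]
  -- Along a geodesic with non-null initial velocity, `ν` takes values in the finite root set of one
  -- nonzero polynomial; a connected subset of it is a point.
  have hnonnull : ∀ v ∈ ball (0 : E) r, G x₀ v v ≠ 0 → ν (X x₀ v T) = ν x₀ := by
    intro v hv hvv
    obtain ⟨hX0, hXc, hX⟩ := hgeo v hv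
    have hp : killingPolynomial b (G x₀) (A x₀) v ≠ 0 := fun hp ↦ hvv (by
      rw [← eval_zero_killingPolynomial b (G x₀) (A x₀) v, hp, eval_zero])
    have hp' : (killingPolynomial b (G x₀) (A x₀) v).map (algebraMap ℝ ℂ) ≠ 0 := by
      rwa [Ne, Polynomial.map_eq_zero]
    have himg : (fun s ↦ ν (X x₀ v s)) '' Icc 0 T ⊆
        {z | ((killingPolynomial b (G x₀) (A x₀) v).map (algebraMap ℝ ℂ)).IsRoot z} := by
      rintro _ ⟨s, hs, rfl⟩
      rw [mem_ofPred_eq, IsRoot.def, eval_map_algebraMap, ← (hX s hs).2]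
      exact hroot _ (hX s hs).1 _
    have hpre : IsPreconnected ((fun s ↦ ν (X x₀ v s)) '' Icc 0 T) :=
      isPreconnected_Icc.image _ (hν.comp hXc fun s hs ↦ (hX s hs).1)
    have hss := (finite_setOfPred_isRoot hp').countable.isTotallyDisconnected _ himg hpre
    have := hss ⟨T, hTm, rfl⟩ ⟨0, h0m, rfl⟩
    simpa only [hX0] using this
  have hall : ∀ v ∈ ball (0 : E) r, ν (X x₀ v T) = ν x₀ := by
    intro v₀ hv₀
    by_contra hne
    set O₁ := ball (0 : E) r ∩ (fun v ↦ ν (X x₀ v T)) ⁻¹' {ν x₀}ᶜ with hO₁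
    have hopen : IsOpen O₁ :=
      (hν.comp hc fun v hv ↦ ((hgeo v hv).2.2 T hTm).1).isOpen_inter_preimage isOpen_ball
        isOpen_compl_singleton
    -- The exceptional velocities form an open set of null vectors. For `A = 0` and `ν = 0` the
    -- common root lemma says that a nonempty such set would force `adj 1 = 0`.
    have hadj := adjugate_eq_zero_of_aeval_killingPolynomial b (A := 0) (ν := 0)
      (h.symm x₀ hx₀) (h.nondegenerate x₀ hx₀) (by simp) hopen ⟨v₀, hv₀, hne⟩ (fun v hv ↦ by
        have h0 : G x₀ v v = 0 := by
          by_contra h0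
          exact hv.2 (hnonnull v hv.1 h0)
        have h1 := aeval_algebraMap_apply ℂ (0 : ℝ) (killingPolynomial b (G x₀) 0 v)
        rw [map_zero] at h1
        rw [h1, coe_aeval_eq_eval, eval_zero_killingPolynomial, h0, map_zero])
    rw [zero_smul, sub_zero, Matrix.adjugate_one] at hadj
    exact one_ne_zero hadj
  filter_upwards [ball_mem_nhds x₀ hδ] with y hy
  obtain ⟨v, hv, rfl⟩ := hsurj hy
  exact hall v hv

/-- Unique continuation of common roots of the Killing polynomials. -/
theorem exists_ball_adjugate_eq_zero (h : CompatibleCoordOn G A Ω) {x₀ : E} (hx₀ : x₀ ∈ Ω) :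
    ∃ δ > 0, ball x₀ δ ⊆ Ω ∧ ∀ (ν : ℂ) (W : Set E), IsOpen W → W.Nonempty → W ⊆ ball x₀ δ →
      (∀ y ∈ W, ∀ v, aeval ν (killingPolynomial b (G y) (A y) v) = 0) → ∀ x ∈ ball x₀ δ,
      (1 - ν • (LinearMap.toMatrix b b (A x : E →ₗ[ℝ] E)).map (algebraMap ℝ ℂ)).adjugate = 0 := by
  obtain ⟨δ, hδ, r, hr, T, hT, X, V, hsub, hflow⟩ :=
    h.exists_geodesic_ball b hx₀ (h.isOpen.mem_nhds hx₀)
  have hTm : T ∈ Icc 0 T := ⟨hT.le, le_rfl⟩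
  refine ⟨δ, hδ, hsub, fun ν W hW hWne hWsub hroot x hx ↦ ?_⟩
  obtain ⟨hc, hsurj, hgeo⟩ := hflow x hx
  obtain ⟨w, hw⟩ := hWne
  obtain ⟨v, hv, hvw⟩ := hsurj (hWsub hw)
  -- Velocities at `x` whose geodesic ends in `W` form a nonempty open set, and conservation of the
  -- polynomial carries the root `ν` back to `x`. The radius `δ` was fixed before `ν` and `W`, as
  -- the later closedness argument requires.
  refine adjugate_eq_zero_of_aeval_killingPolynomial b (h.symm x (hsub hx))
    (h.nondegenerate x (hsub hx)) (h.selfadjoint x (hsub hx))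
    (hc.isOpen_inter_preimage isOpen_ball hW) ⟨v, hv, ?_⟩ fun z hz ↦ ?_
  · exact (congrArg (· ∈ W) hvw).mpr hw
  · rw [← ((hgeo z hz.1).2.2 T hTm).2]
    exact hroot _ hz.2 _

end CompatibleCoordOn
end GeodesicConsequences
end GeodEquiv

/-! ### Transformation of Christoffel symbols and covariant derivatives. -/

namespace GeodEquiv

section ChangeOfCoordinates

variable {E : Type*} [NormedAddCommGroup E] [NormedSpace ℝ E]
  {G G' : E → E →L[ℝ] E →L[ℝ] ℝ} {A A' : E → E →L[ℝ] E} {τ : E → E} {y : E}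

theorem fderiv_metric_comp (hτ : ContDiffAt ℝ ∞ τ y) (hG : DifferentiableAt ℝ G (τ y))
    (hG' : DifferentiableAt ℝ G' y)
    (hpull : ∀ᶠ z in 𝓝 y, ∀ u v, G' z u v = G (τ z) (fderiv ℝ τ z u) (fderiv ℝ τ z v))
    (u v w : E) : fderiv ℝ G' y u v w =
      fderiv ℝ G (τ y) (fderiv ℝ τ y u) (fderiv ℝ τ y v) (fderiv ℝ τ y w) +
      G (τ y) (fderiv ℝ (fderiv ℝ τ) y u v) (fderiv ℝ τ y w) +
      G (τ y) (fderiv ℝ τ y v) (fderiv ℝ (fderiv ℝ τ) y u w) := by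
  have hc : HasDerivAt (fun t : ℝ ↦ y + t • u) u 0 := by
    simpa using ((hasDerivAt_id (0 : ℝ)).smul_const u).const_add y
  have hy : y + (0 : ℝ) • u = y := by simp
  have hτd : DifferentiableAt ℝ τ y := hτ.differentiableAt (by simp)
  have hτd' : DifferentiableAt ℝ (fderiv ℝ τ) y :=
    (hτ.fderiv_right (m := 1) (by norm_cast)).differentiableAt (by simp)
  have h1 : HasDerivAt (fun t : ℝ ↦ G' (y + t • u) v w) (fderiv ℝ G' y u v w) 0 := by
    have := hasDerivAt_comp_of_differentiableAt (f := G') hc (by rwa [hy])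
    rw [hy] at this
    have h2 := (this.clm_apply (hasDerivAt_const (0 : ℝ) v)).clm_apply (hasDerivAt_const (0 : ℝ) w)
    simpa using h2
  have hτc : HasDerivAt (fun t : ℝ ↦ τ (y + t • u)) (fderiv ℝ τ y u) 0 := by
    have := hasDerivAt_comp_of_differentiableAt (f := τ) hc (by rwa [hy])
    rwa [hy] at this
  have hDc : HasDerivAt (fun t : ℝ ↦ fderiv ℝ τ (y + t • u)) (fderiv ℝ (fderiv ℝ τ) y u) 0 := by
    have := hasDerivAt_comp_of_differentiableAt (f := fderiv ℝ τ) hc (by rwa [hy])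
    rwa [hy] at this
  have hGc : HasDerivAt (fun t : ℝ ↦ G (τ (y + t • u))) (fderiv ℝ G (τ y) (fderiv ℝ τ y u)) 0 := by
    have := hasDerivAt_comp_of_differentiableAt (f := G) hτc (by rwa [hy])
    rwa [hy] at this
  have h3 := (hGc.clm_apply (hDc.clm_apply (hasDerivAt_const (0 : ℝ) v))).clm_apply
    (hDc.clm_apply (hasDerivAt_const (0 : ℝ) w))
  have hev : ∀ᶠ t : ℝ in 𝓝 0, G' (y + t • u) v w = G (τ (y + t • u))
      (fderiv ℝ τ (y + t • u) v) (fderiv ℝ τ (y + t • u) w) := by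
    have hct : Filter.Tendsto (fun t : ℝ ↦ y + t • u) (𝓝 0) (𝓝 y) := by
      simpa using hc.continuousAt.tendsto
    exact (hct.eventually hpull).mono fun t ht ↦ ht v w
  have h4 := (h3.congr_of_eventuallyEq hev).unique h1
  rw [← h4, hy]
  simp

/-- Differentiating the intertwining relation `Dτ A' = A Dτ`, instead of a conjugation formula,
avoids the inverse of `Dτ`. -/
theorem fderiv_tensor_comp (hτ : ContDiffAt ℝ ∞ τ y) (hA : DifferentiableAt ℝ A (τ y))
    (hA' : DifferentiableAt ℝ A' y)
    (hpull : ∀ᶠ z in 𝓝 y, ∀ v, fderiv ℝ τ z (A' z v) = A (τ z) (fderiv ℝ τ z v)) (u v : E) :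
    fderiv ℝ (fderiv ℝ τ) y u (A' y v) + fderiv ℝ τ y (fderiv ℝ A' y u v) =
      fderiv ℝ A (τ y) (fderiv ℝ τ y u) (fderiv ℝ τ y v) +
        A (τ y) (fderiv ℝ (fderiv ℝ τ) y u v) := by
  have hc : HasDerivAt (fun t : ℝ ↦ y + t • u) u 0 := by
    simpa using ((hasDerivAt_id (0 : ℝ)).smul_const u).const_add y
  have hy : y + (0 : ℝ) • u = y := by simp
  have hτd : DifferentiableAt ℝ τ y := hτ.differentiableAt (by simp)
  have hτd' : DifferentiableAt ℝ (fderiv ℝ τ) y :=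
    (hτ.fderiv_right (m := 1) (by norm_cast)).differentiableAt (by simp)
  have hAc' : HasDerivAt (fun t : ℝ ↦ A' (y + t • u)) (fderiv ℝ A' y u) 0 := by
    have := hasDerivAt_comp_of_differentiableAt (f := A') hc (by rwa [hy])
    rwa [hy] at this
  have hτc : HasDerivAt (fun t : ℝ ↦ τ (y + t • u)) (fderiv ℝ τ y u) 0 := by
    have := hasDerivAt_comp_of_differentiableAt (f := τ) hc (by rwa [hy])
    rwa [hy] at this
  have hDc : HasDerivAt (fun t : ℝ ↦ fderiv ℝ τ (y + t • u)) (fderiv ℝ (fderiv ℝ τ) y u) 0 := by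
    have := hasDerivAt_comp_of_differentiableAt (f := fderiv ℝ τ) hc (by rwa [hy])
    rwa [hy] at this
  have hAc : HasDerivAt (fun t : ℝ ↦ A (τ (y + t • u))) (fderiv ℝ A (τ y) (fderiv ℝ τ y u)) 0 := by
    have := hasDerivAt_comp_of_differentiableAt (f := A) hτc (by rwa [hy])
    rwa [hy] at this
  have h1 := hDc.clm_apply (hAc'.clm_apply (hasDerivAt_const (0 : ℝ) v))
  have h2 := hAc.clm_apply (hDc.clm_apply (hasDerivAt_const (0 : ℝ) v))
  have hev : ∀ᶠ t : ℝ in 𝓝 0, fderiv ℝ τ (y + t • u) (A' (y + t • u) v) =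
      A (τ (y + t • u)) (fderiv ℝ τ (y + t • u) v) := by
    have hct : Filter.Tendsto (fun t : ℝ ↦ y + t • u) (𝓝 0) (𝓝 y) := by
      simpa using hc.continuousAt.tendsto
    exact (hct.eventually hpull).mono fun t ht ↦ ht v
  have h4 := (h2.congr_of_eventuallyEq hev).unique h1
  simpa [hy] using h4.symm

variable [FiniteDimensional ℝ E]

/-- The transformation law of the Christoffel symbols. -/
theorem christoffel_comp (hτ : ContDiffAt ℝ ∞ τ y) (hG : DifferentiableAt ℝ G (τ y))
    (hG' : DifferentiableAt ℝ G' y)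
    (hpull : ∀ᶠ z in 𝓝 y, ∀ u v, G' z u v = G (τ z) (fderiv ℝ τ z u) (fderiv ℝ τ z v))
    (hsymm : ∀ u v, G (τ y) u v = G (τ y) v u)
    (hnd : ∀ u, (∀ v, G (τ y) u v = 0) → u = 0) (hnd' : ∀ u, (∀ v, G' y u v = 0) → u = 0)
    (hsurj : Function.Surjective (fderiv ℝ τ y)) (u v : E) :
    fderiv ℝ τ y (christoffel G' y u v) =
      christoffel G (τ y) (fderiv ℝ τ y u) (fderiv ℝ τ y v) +
        fderiv ℝ (fderiv ℝ τ) y u v := by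
  -- A preimage of the right side is shown to satisfy the formula characterising `christoffel G' y u
  -- v`; the terms with `D²τ` combine because `D²τ` is symmetric.
  obtain ⟨z, hz⟩ := hsurj (christoffel G (τ y) (fderiv ℝ τ y u) (fderiv ℝ τ y v) +
        fderiv ℝ (fderiv ℝ τ) y u v)
  rw [christoffel_unique hnd' (z := z), hz]
  have hsnd : ∀ a b, fderiv ℝ (fderiv ℝ τ) y a b = fderiv ℝ (fderiv ℝ τ) y b a := fun a b ↦
    (hτ.isSymmSndFDerivAt (by simp; norm_cast)).eq a b
  intro w
  rw [hpull.self_of_nhds, hz, map_add, add_apply,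
    christoffel_spec (isInvertible_of_nondegenerate hnd),
    fderiv_metric_comp hτ hG hG' hpull, fderiv_metric_comp hτ hG hG' hpull,
    fderiv_metric_comp hτ hG hG' hpull, hsnd v u, hsnd w u, hsnd w v,
    hsymm (fderiv ℝ τ y v), hsymm (fderiv ℝ τ y u)]
  ring

/-- The covariant derivative of an endomorphism field is a tensor. -/
theorem covDerivTensor_comp (hτ : ContDiffAt ℝ ∞ τ y) (hG : DifferentiableAt ℝ G (τ y))
    (hG' : DifferentiableAt ℝ G' y)
    (hpull : ∀ᶠ z in 𝓝 y, ∀ u v, G' z u v = G (τ z) (fderiv ℝ τ z u) (fderiv ℝ τ z v))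
    (hsymm : ∀ u v, G (τ y) u v = G (τ y) v u)
    (hnd : ∀ u, (∀ v, G (τ y) u v = 0) → u = 0) (hnd' : ∀ u, (∀ v, G' y u v = 0) → u = 0)
    (hsurj : Function.Surjective (fderiv ℝ τ y)) (hA : DifferentiableAt ℝ A (τ y))
    (hA' : DifferentiableAt ℝ A' y)
    (hpullA : ∀ᶠ z in 𝓝 y, ∀ v, fderiv ℝ τ z (A' z v) = A (τ z) (fderiv ℝ τ z v)) (u v : E) :
    fderiv ℝ τ y (covDerivTensor G' A' y u v) =
      covDerivTensor G A (τ y) (fderiv ℝ τ y u) (fderiv ℝ τ y v) := by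
  have hΓ := christoffel_comp hτ hG hG' hpull hsymm hnd hnd' hsurj
  have h1 := fderiv_tensor_comp hτ hA hA' hpullA u v
  have h2 := hpullA.self_of_nhds
  rw [covDerivTensor, covDerivTensor, map_sub, map_add, h2, hΓ, hΓ, h2, map_add,
    ← sub_eq_iff_eq_add'.mpr h1.symm]
  abel

end ChangeOfCoordinates
end GeodEquiv

/-! ### Smoothness of the components of `g` and `L` in charts. -/

namespace GeodEquiv

section Charts

open Module Set Bundle

variable {n : ℕ} {M : Type*} [TopologicalSpace M] [ChartedSpace (EuclideanSpace ℝ (Fin n)) M]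

theorem bilinInChart_apply (g : BilinField n M) (c : M) (y u v : EuclideanSpace ℝ (Fin n)) :
    bilinInChart g c y u v =
      g ((extChartAt (𝓡 n) c).symm y) (chartFrame c y u) (chartFrame c y v) := rfl

theorem endInChart_apply (L : EndField n M) (c : M) (y v : EuclideanSpace ℝ (Fin n)) :
    endInChart L c y v =
      chartCoframe c y (L ((extChartAt (𝓡 n) c).symm y) (chartFrame c y v)) := rfl

variable [IsManifold (𝓡 n) ∞ M]

theorem isManifold_one : IsManifold (𝓡 n) 1 M := IsManifold.of_le (n := ∞) (by norm_cast)

variable {c : M} {y : EuclideanSpace ℝ (Fin n)}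

theorem chartCoframe_comp_chartFrame (hy : y ∈ (extChartAt (𝓡 n) c).target) :
    chartCoframe c y ∘L chartFrame c y = ContinuousLinearMap.id ℝ _ := by
  have := isManifold_one (n := n) (M := M)
  have h := mfderiv_extChartAt_comp_mfderivWithin_extChartAt_symm hy
  rwa [modelWithCornersSelf_coe, range_id, mfderivWithin_univ] at h

theorem chartFrame_comp_chartCoframe (hy : y ∈ (extChartAt (𝓡 n) c).target) :
    chartFrame c y ∘L chartCoframe c y = ContinuousLinearMap.id ℝ _ := by
  have := isManifold_one (n := n) (M := M)
  have h := mfderivWithin_extChartAt_symm_comp_mfderiv_extChartAt hy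
  rwa [modelWithCornersSelf_coe, range_id, mfderivWithin_univ] at h

theorem chartCoframe_chartFrame (hy : y ∈ (extChartAt (𝓡 n) c).target)
    (v : EuclideanSpace ℝ (Fin n)) : chartCoframe c y (chartFrame c y v) = v :=
  DFunLike.congr_fun (chartCoframe_comp_chartFrame hy) v

theorem chartFrame_chartCoframe (hy : y ∈ (extChartAt (𝓡 n) c).target)
    (v : TangentSpace (𝓡 n) ((extChartAt (𝓡 n) c).symm y)) :
    chartFrame c y (chartCoframe c y v) = v :=
  DFunLike.congr_fun (chartFrame_comp_chartCoframe hy) v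

theorem chartFrame_endInChart (L : EndField n M) (hy : y ∈ (extChartAt (𝓡 n) c).target)
    (v : EuclideanSpace ℝ (Fin n)) : chartFrame c y (endInChart L c y v) =
      L ((extChartAt (𝓡 n) c).symm y) (chartFrame c y v) := by
  rw [endInChart_apply, chartFrame_chartCoframe hy]

/-- Bridge between smoothness stated through bundle trivialisations and components stated through
differentials of charts. -/
theorem symmL_eq_chartFrame (hy : y ∈ (extChartAt (𝓡 n) c).target) :
    (trivializationAt (EuclideanSpace ℝ (Fin n)) (TangentSpace (𝓡 n)) c).symmL ℝ
      ((extChartAt (𝓡 n) c).symm y) = chartFrame c y := by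
  have := isManifold_one (n := n) (M := M)
  rw [TangentBundle.symmL_trivializationAt (by
    simpa using (extChartAt (𝓡 n) c).map_target hy), (extChartAt (𝓡 n) c).right_inv hy,
    modelWithCornersSelf_coe, range_id, mfderivWithin_univ]
  rfl

theorem continuousLinearMapAt_eq_chartCoframe (hy : y ∈ (extChartAt (𝓡 n) c).target) :
    (trivializationAt (EuclideanSpace ℝ (Fin n)) (TangentSpace (𝓡 n)) c).continuousLinearMapAt ℝ
      ((extChartAt (𝓡 n) c).symm y) = chartCoframe c y := by
  have := isManifold_one (n := n) (M := M)
  rw [TangentBundle.continuousLinearMapAt_trivializationAt (by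
    simpa using (extChartAt (𝓡 n) c).map_target hy)]
  rfl

theorem mem_baseSet_of_mem_target (hy : y ∈ (extChartAt (𝓡 n) c).target) :
    (extChartAt (𝓡 n) c).symm y ∈
      (trivializationAt (EuclideanSpace ℝ (Fin n)) (TangentSpace (𝓡 n)) c).baseSet := by
  simpa using (extChartAt (𝓡 n) c).map_target hy

/-- Coordinate vector fields, along the inverse of a chart, are smooth. -/
theorem contMDiffAt_chartFrame (hy : y ∈ (extChartAt (𝓡 n) c).target)
    (v : EuclideanSpace ℝ (Fin n)) :
    ContMDiffAt 𝓘(ℝ, EuclideanSpace ℝ (Fin n)) (𝓡 n).tangent ∞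
      (fun z ↦ TotalSpace.mk' (EuclideanSpace ℝ (Fin n)) (E := TangentSpace (𝓡 n) (M := M))
        ((extChartAt (𝓡 n) c).symm z) (chartFrame c z v)) y := by
  have ho := (isOpen_extChartAt_target (I := 𝓡 n) c).mem_nhds hy
  rw [(trivializationAt (EuclideanSpace ℝ (Fin n)) (TangentSpace (𝓡 n)) c).contMDiffAt_iff
    (by simpa using (extChartAt (𝓡 n) c).map_target hy)]
  refine ⟨(contMDiffOn_extChartAt_symm c).contMDiffAt ho, ?_⟩
  refine (contMDiffAt_const (c := v)).congr_of_eventuallyEq ?_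
  filter_upwards [ho] with z hz
  have h1 := chartCoframe_chartFrame hz v
  rw [← continuousLinearMapAt_eq_chartCoframe hz] at h1
  rwa [Trivialization.continuousLinearMapAt_apply,
    Trivialization.linearMapAt_apply, if_pos (mem_baseSet_of_mem_target hz)] at h1

/-- Each component is the pairing by `g` of two smooth coordinate fields, and in finite dimension
fixed pairs of vectors suffice. -/
theorem contDiffOn_bilinInChart {g : BilinField n M} (hg : IsPseudoRiemannianMetric g) (c : M) :
    ContDiffOn ℝ ∞ (bilinInChart g c) (extChartAt (𝓡 n) c).target := by
  intro y hy
  have ho := (isOpen_extChartAt_target (I := 𝓡 n) c).mem_nhds hy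
  refine ContDiffAt.contDiffWithinAt ?_
  refine contDiffAt_of_forall_apply fun u ↦ contDiffAt_of_forall_apply fun v ↦ ?_
  have h : ContMDiffAt 𝓘(ℝ, EuclideanSpace ℝ (Fin n)) ((𝓡 n).prod 𝓘(ℝ, ℝ)) ∞
      (fun z ↦ TotalSpace.mk' ℝ (E := Bundle.Trivial M ℝ) ((extChartAt (𝓡 n) c).symm z)
        (g ((extChartAt (𝓡 n) c).symm z) (chartFrame c z u) (chartFrame c z v))) y := by
    apply ContMDiffAt.clm_bundle_apply₂ (F₁ := EuclideanSpace ℝ (Fin n))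
      (F₂ := EuclideanSpace ℝ (Fin n))
    · exact hg.contMDiff.contMDiffAt.comp y ((contMDiffOn_extChartAt_symm c).contMDiffAt ho)
    · exact contMDiffAt_chartFrame hy u
    · exact contMDiffAt_chartFrame hy v
  rw [contMDiffAt_totalSpace] at h
  exact h.2.contDiffAt

theorem contDiffOn_endInChart {L : EndField n M} (hL : IsSmoothEndField L) (c : M) :
    ContDiffOn ℝ ∞ (endInChart L c) (extChartAt (𝓡 n) c).target := by
  intro y hy
  have ho := (isOpen_extChartAt_target (I := 𝓡 n) c).mem_nhds hy
  refine ContDiffAt.contDiffWithinAt ?_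
  refine contDiffAt_of_forall_apply fun v ↦ ?_
  have h : ContMDiffAt 𝓘(ℝ, EuclideanSpace ℝ (Fin n)) (𝓡 n).tangent ∞
      (fun z ↦ TotalSpace.mk' (EuclideanSpace ℝ (Fin n)) (E := TangentSpace (𝓡 n) (M := M))
        ((extChartAt (𝓡 n) c).symm z)
        (L ((extChartAt (𝓡 n) c).symm z) (chartFrame c z v))) y := by
    apply ContMDiffAt.clm_bundle_apply (F₁ := EuclideanSpace ℝ (Fin n))
    · exact hL.contMDiffAt.comp y ((contMDiffOn_extChartAt_symm c).contMDiffAt ho)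
    · exact contMDiffAt_chartFrame hy v
  rw [(trivializationAt (EuclideanSpace ℝ (Fin n)) (TangentSpace (𝓡 n)) c).contMDiffAt_iff
    (by simpa using (extChartAt (𝓡 n) c).map_target hy)] at h
  refine h.2.contDiffAt.congr_of_eventuallyEq ?_
  filter_upwards [ho] with z hz
  rw [endInChart_apply, ← continuousLinearMapAt_eq_chartCoframe hz,
    Trivialization.continuousLinearMapAt_apply,
    Trivialization.linearMapAt_apply, if_pos (mem_baseSet_of_mem_target hz)]

end Charts

end GeodEquiv

/-! ### Transition between preferred charts. -/

namespace GeodEquiv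

section ChartChange

open Module Set Bundle Filter

variable {n : ℕ} {M : Type*} [TopologicalSpace M] [ChartedSpace (EuclideanSpace ℝ (Fin n)) M]

/-- The transition map from the preferred chart at `c` to the preferred chart at `x`. -/
noncomputable def transition (c x : M) (z : EuclideanSpace ℝ (Fin n)) :
    EuclideanSpace ℝ (Fin n) :=
  extChartAt (𝓡 n) x ((extChartAt (𝓡 n) c).symm z)

/-- Tangent spaces at propositionally equal points are distinct types, but all unfold to `ℝⁿ`;
vectors are therefore compared there. -/
theorem bilinField_congr (g : BilinField n M) {p q : M} (h : p = q)
    {u v u' v' : EuclideanSpace ℝ (Fin n)} (hu : u = u') (hv : v = v') :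
    g p (show TangentSpace (𝓡 n) p from u) (show TangentSpace (𝓡 n) p from v) =
      g q (show TangentSpace (𝓡 n) q from u') (show TangentSpace (𝓡 n) q from v') := by
  subst h hu hv
  rfl

theorem endField_congr (L : EndField n M) {p q : M} (h : p = q)
    {v v' : EuclideanSpace ℝ (Fin n)} (hv : v = v') :
    (show EuclideanSpace ℝ (Fin n) from L p (show TangentSpace (𝓡 n) p from v)) =
      (show EuclideanSpace ℝ (Fin n) from L q (show TangentSpace (𝓡 n) q from v')) := by
  subst h hv
  rfl

theorem chartFrame_self [IsManifold (𝓡 n) ∞ M] (x : M) (v : EuclideanSpace ℝ (Fin n)) :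
    (show EuclideanSpace ℝ (Fin n) from chartFrame x (extChartAt (𝓡 n) x x) v) = v := by
  have := isManifold_one (n := n) (M := M)
  have h := mfderivWithin_range_extChartAt_symm (I := 𝓡 n) (x := x)
  rw [modelWithCornersSelf_coe, range_id, mfderivWithin_univ] at h
  exact DFunLike.congr_fun h v

theorem bilinInChart_self [IsManifold (𝓡 n) ∞ M] (g : BilinField n M) (x : M)
    (u v : EuclideanSpace ℝ (Fin n)) :
    bilinInChart g x (extChartAt (𝓡 n) x x) u v =
      g x (show TangentSpace (𝓡 n) x from u) (show TangentSpace (𝓡 n) x from v) :=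
  bilinField_congr g (extChartAt_to_inv x) (chartFrame_self x u) (chartFrame_self x v)

variable {c x : M} {y z : EuclideanSpace ℝ (Fin n)}

theorem eventually_mem_source (hy : y ∈ (extChartAt (𝓡 n) c).target)
    (hx : (extChartAt (𝓡 n) c).symm y ∈ (extChartAt (𝓡 n) x).source) :
    ∀ᶠ z in 𝓝 y, z ∈ (extChartAt (𝓡 n) c).target ∧
      (extChartAt (𝓡 n) c).symm z ∈ (extChartAt (𝓡 n) x).source := by
  have ho := (isOpen_extChartAt_target (I := 𝓡 n) c).mem_nhds hy
  refine Filter.Eventually.and ho ?_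
  have hc : ContinuousAt (extChartAt (𝓡 n) c).symm y := (continuousOn_extChartAt_symm c).continuousAt ho
  exact hc.eventually_mem ((isOpen_extChartAt_source (I := 𝓡 n) x).mem_nhds hx)

variable [IsManifold (𝓡 n) ∞ M]

theorem contDiffAt_transition (hz : z ∈ (extChartAt (𝓡 n) c).target)
    (hx : (extChartAt (𝓡 n) c).symm z ∈ (extChartAt (𝓡 n) x).source) :
    ContDiffAt ℝ ∞ (transition c x) z := by
  have h1 := (contMDiffOn_extChartAt_symm (I := 𝓡 n) (n := ∞) c).contMDiffAt
    ((isOpen_extChartAt_target (I := 𝓡 n) c).mem_nhds hz)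
  have h2 := contMDiffAt_extChartAt' (I := 𝓡 n) (n := ∞) (x := x) (by simpa using hx)
  exact (h2.comp z h1).contDiffAt

/-- Chain rule for `φ_c⁻¹ = φ_x⁻¹ ∘ τ`, which holds near `z`. -/
theorem chartFrame_transition (hz : z ∈ (extChartAt (𝓡 n) c).target)
    (hx : (extChartAt (𝓡 n) c).symm z ∈ (extChartAt (𝓡 n) x).source)
    (v : EuclideanSpace ℝ (Fin n)) :
    (show EuclideanSpace ℝ (Fin n) from
      chartFrame x (transition c x z) (fderiv ℝ (transition c x) z v)) =
    (show EuclideanSpace ℝ (Fin n) from chartFrame c z v) := by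
  have hm := isManifold_one (n := n) (M := M)
  have hev : (extChartAt (𝓡 n) c).symm =ᶠ[𝓝 z] (extChartAt (𝓡 n) x).symm ∘ transition c x := by
    filter_upwards [eventually_mem_source hz hx] with w hw
    exact ((extChartAt (𝓡 n) x).left_inv hw.2).symm
  have hτ : DifferentiableAt ℝ (transition c x) z :=
    (contDiffAt_transition hz hx).differentiableAt (by simp)
  have hxs : MDifferentiableAt 𝓘(ℝ, EuclideanSpace ℝ (Fin n)) (𝓡 n) (extChartAt (𝓡 n) x).symm
      (transition c x z) :=
    ((contMDiffOn_extChartAt_symm (I := 𝓡 n) (n := 1) x).contMDiffAt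
      ((isOpen_extChartAt_target (I := 𝓡 n) x).mem_nhds
        ((extChartAt (𝓡 n) x).map_source hx))).mdifferentiableAt (by simp)
  have h1 := hev.mfderiv_eq (I := 𝓘(ℝ, EuclideanSpace ℝ (Fin n))) (I' := 𝓡 n)
  have h2 := mfderiv_comp z hxs hτ.mdifferentiableAt
  rw [mfderiv_eq_fderiv] at h2
  exact (DFunLike.congr_fun (h1.trans h2) v).symm

theorem bilinInChart_transition (g : BilinField n M) (hz : z ∈ (extChartAt (𝓡 n) c).target)
    (hx : (extChartAt (𝓡 n) c).symm z ∈ (extChartAt (𝓡 n) x).source)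
    (u v : EuclideanSpace ℝ (Fin n)) :
    bilinInChart g c z u v = bilinInChart g x (transition c x z)
      (fderiv ℝ (transition c x) z u) (fderiv ℝ (transition c x) z v) :=
  bilinField_congr g ((extChartAt (𝓡 n) x).left_inv hx).symm (chartFrame_transition hz hx u).symm
    (chartFrame_transition hz hx v).symm

theorem endInChart_transition (L : EndField n M) (hz : z ∈ (extChartAt (𝓡 n) c).target)
    (hx : (extChartAt (𝓡 n) c).symm z ∈ (extChartAt (𝓡 n) x).source)
    (v : EuclideanSpace ℝ (Fin n)) :
    fderiv ℝ (transition c x) z (endInChart L c z v) =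
      endInChart L x (transition c x z) (fderiv ℝ (transition c x) z v) := by
  have hx' : transition c x z ∈ (extChartAt (𝓡 n) x).target := (extChartAt (𝓡 n) x).map_source hx
  rw [← chartCoframe_chartFrame hx' (fderiv ℝ (transition c x) z (endInChart L c z v)),
    endInChart_apply L x]
  congr 1
  refine (chartFrame_transition hz hx _).trans ?_
  refine (chartFrame_endInChart L hz v).trans ?_
  exact endField_congr L ((extChartAt (𝓡 n) x).left_inv hx).symm (chartFrame_transition hz hx v).symm

/-- The differential of a chart, as an isomorphism from the model space to a tangent space. -/
noncomputable def chartFrameEquiv (hy : y ∈ (extChartAt (𝓡 n) c).target) :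
    EuclideanSpace ℝ (Fin n) ≃ₗ[ℝ] TangentSpace (𝓡 n) ((extChartAt (𝓡 n) c).symm y) :=
  LinearEquiv.ofLinearMap (chartFrame c y).toLinearMap (chartCoframe c y).toLinearMap
    (LinearMap.ext (chartFrame_chartCoframe hy)) (LinearMap.ext (chartCoframe_chartFrame hy))

theorem trace_endInChart (L : EndField n M) (hy : y ∈ (extChartAt (𝓡 n) c).target) :
    LinearMap.trace ℝ _ (endInChart L c y).toLinearMap =
      LinearMap.trace ℝ _ (L ((extChartAt (𝓡 n) c).symm y)).toLinearMap :=
  LinearMap.trace_conj' (L ((extChartAt (𝓡 n) c).symm y)).toLinearMap (chartFrameEquiv hy).symm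

theorem det_endInChart (L : EndField n M) (hy : y ∈ (extChartAt (𝓡 n) c).target) :
    LinearMap.det (endInChart L c y).toLinearMap =
      LinearMap.det (L ((extChartAt (𝓡 n) c).symm y)).toLinearMap :=
  LinearMap.det_conj (L ((extChartAt (𝓡 n) c).symm y)).toLinearMap (chartFrameEquiv hy).symm

end ChartChange

end GeodEquiv

/-! ### Compatibility in an arbitrary chart. -/

namespace GeodEquiv

section CompatibleInChart

open Module Set Bundle Filter

variable {n : ℕ} {M : Type*} [TopologicalSpace M] [ChartedSpace (EuclideanSpace ℝ (Fin n)) M]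
  [IsManifold (𝓡 n) ∞ M] {c x : M} {y z : EuclideanSpace ℝ (Fin n)}
  {g : BilinField n M} {L : EndField n M}

/-- The differential of the trace of an endomorphism field on a normed space. -/
noncomputable def traceFDeriv {E : Type*} [NormedAddCommGroup E] [NormedSpace ℝ E]
    [FiniteDimensional ℝ E] (A : E → E →L[ℝ] E) (y : E) : E →L[ℝ] ℝ :=
  LinearMap.toContinuousLinearMap (LinearMap.trace ℝ E ∘ₗ
    ContinuousLinearMap.coeLM ℝ ∘ₗ (fderiv ℝ A y).toLinearMap)

theorem hasFDerivAt_trace {E : Type*} [NormedAddCommGroup E] [NormedSpace ℝ E]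
    [FiniteDimensional ℝ E] {A : E → E →L[ℝ] E} {y : E} (hA : DifferentiableAt ℝ A y) :
    HasFDerivAt (fun z ↦ LinearMap.trace ℝ E (A z).toLinearMap) (traceFDeriv A y) y := by
  let T : (E →L[ℝ] E) →L[ℝ] ℝ :=
    LinearMap.toContinuousLinearMap (LinearMap.trace ℝ E ∘ₗ ContinuousLinearMap.coeLM ℝ)
  exact (T.hasFDerivAt (x := A y)).comp y hA.hasFDerivAt

theorem differentiableAt_bilinInChart (hg : IsPseudoRiemannianMetric g)
    (hy : y ∈ (extChartAt (𝓡 n) c).target) : DifferentiableAt ℝ (bilinInChart g c) y :=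
  ((contDiffOn_bilinInChart hg c).contDiffAt
    ((isOpen_extChartAt_target c).mem_nhds hy)).differentiableAt (by simp)

theorem differentiableAt_endInChart (hL : IsSmoothEndField L)
    (hy : y ∈ (extChartAt (𝓡 n) c).target) : DifferentiableAt ℝ (endInChart L c) y :=
  ((contDiffOn_endInChart hL c).contDiffAt
    ((isOpen_extChartAt_target c).mem_nhds hy)).differentiableAt (by simp)

theorem trace_endInChart_transition (L : EndField n M) (hz : z ∈ (extChartAt (𝓡 n) c).target)
    (hx : (extChartAt (𝓡 n) c).symm z ∈ (extChartAt (𝓡 n) x).source) :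
    LinearMap.trace ℝ _ (endInChart L c z).toLinearMap =
      LinearMap.trace ℝ _ (endInChart L x (transition c x z)).toLinearMap := by
  have h := trace_endInChart L ((extChartAt (𝓡 n) x).map_source hx)
  rw [(extChartAt (𝓡 n) x).left_inv hx] at h
  exact (trace_endInChart L hz).trans h.symm

theorem trace_eventuallyEq (L : EndField n M) (x : M) :
    (fun p ↦ LinearMap.trace ℝ (TangentSpace (𝓡 n) p) (L p).toLinearMap) =ᶠ[𝓝 x]
      (fun z ↦ LinearMap.trace ℝ _ (endInChart L x z).toLinearMap) ∘ extChartAt (𝓡 n) x := by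
  filter_upwards [extChartAt_source_mem_nhds (I := 𝓡 n) x] with p hp
  have h := trace_endInChart L ((extChartAt (𝓡 n) x).map_source hp)
  rw [(extChartAt (𝓡 n) x).left_inv hp] at h
  exact h.symm

theorem hasMFDerivAt_trace (hL : IsSmoothEndField L) (x : M) :
    HasMFDerivAt (𝓡 n) 𝓘(ℝ, ℝ)
      (fun p ↦ LinearMap.trace ℝ (TangentSpace (𝓡 n) p) (L p).toLinearMap) x
      (traceFDeriv (endInChart L x) (extChartAt (𝓡 n) x x)) := by
  have hm := isManifold_one (n := n) (M := M)
  have h1 := hasFDerivAt_trace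
    (differentiableAt_endInChart hL (mem_extChartAt_target (I := 𝓡 n) x))
  have h2 := (mdifferentiableAt_extChartAt (I := 𝓡 n) (mem_chart_source _ x)).hasMFDerivAt
  rw [mfderiv_extChartAt_self] at h2
  have h3 := (h1.hasMFDerivAt.comp x h2).congr_of_eventuallyEq (trace_eventuallyEq L x)
  exact h3

theorem dTrace_apply (hL : IsSmoothEndField L) (x : M) (v : EuclideanSpace ℝ (Fin n)) :
    dTrace L x v = LinearMap.trace ℝ (EuclideanSpace ℝ (Fin n))
      (fderiv ℝ (endInChart L x) (extChartAt (𝓡 n) x x) v).toLinearMap := by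
  rw [dTrace, (hasMFDerivAt_trace hL x).mfderiv]
  rfl

theorem continuous_trace (hL : IsSmoothEndField L) :
    Continuous fun p : M ↦ LinearMap.trace ℝ (TangentSpace (𝓡 n) p) (L p).toLinearMap :=
  continuous_iff_continuousAt.mpr fun x ↦ (hasMFDerivAt_trace hL x).continuousAt

theorem IsPseudoRiemannianMetric.bilinInChart_nondegenerate (hg : IsPseudoRiemannianMetric g)
    (hy : y ∈ (extChartAt (𝓡 n) c).target) (u : EuclideanSpace ℝ (Fin n))
    (h : ∀ v, bilinInChart g c y u v = 0) : u = 0 := by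
  rw [← chartCoframe_chartFrame hy u, hg.nondegenerate _ (chartFrame c y u), map_zero]
  intro v
  rw [← chartFrame_chartCoframe hy v]
  exact h _

theorem IsPseudoRiemannianMetric.isInvertible (hg : IsPseudoRiemannianMetric g) (x : M) :
    (g x).IsInvertible :=
  isInvertible_of_nondegenerate (E := EuclideanSpace ℝ (Fin n)) (hg.nondegenerate x)

theorem gAdjoint_spec (hg : IsPseudoRiemannianMetric g)
    (B : TangentSpace (𝓡 n) x →L[ℝ] TangentSpace (𝓡 n) x) (v w : TangentSpace (𝓡 n) x) :
    g x (gAdjoint g B v) w = g x v (B w) := by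
  have h : g x (gAdjoint g B v) = ContinuousLinearMap.precomp ℝ B (g x v) :=
    (hg.isInvertible x).self_apply_inverse _
  rw [h]
  rfl

/-- Pairing with `w` moves the adjoint onto `w`, so that no inverse of `g` is left. -/
theorem Compatible.apply_covDerivEnd (hg : IsPseudoRiemannianMetric g) (hL : Compatible g L)
    (u v w : TangentSpace (𝓡 n) x) : g x (covDerivEnd g L x u v) w =
      1 / 2 * (dTrace L x v * g x u w + g x u v * dTrace L x w) := by
  have h3 := gAdjoint_spec hg (tensorEnd u (dTrace L x)) v w
  have h4 : ∀ w, tensorEnd u (dTrace L x) w = dTrace L x w • u := fun w ↦ rfl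
  rw [h4, map_smul, smul_eq_mul, hg.symm x v u] at h3
  rw [hL.main, map_smul, smul_apply, add_apply, map_add,
    add_apply, h3, h4, map_smul, smul_apply]
  simp only [smul_eq_mul]
  ring

/-- `covDerivEnd` uses at each point the preferred chart of that point, so the hypothesis directly
gives the coordinate equation only at the image of `x` in its own chart. -/
theorem Compatible.main_self (hg : IsPseudoRiemannianMetric g) (hL : Compatible g L) (x : M)
    (u v w : EuclideanSpace ℝ (Fin n)) :
    bilinInChart g x (extChartAt (𝓡 n) x x)
      (covDerivTensor (bilinInChart g x) (endInChart L x) (extChartAt (𝓡 n) x x) u v) w = 1 / 2 *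
      (LinearMap.trace ℝ _ (fderiv ℝ (endInChart L x) (extChartAt (𝓡 n) x x) v).toLinearMap *
        bilinInChart g x (extChartAt (𝓡 n) x x) u w +
      bilinInChart g x (extChartAt (𝓡 n) x x) u v *
        LinearMap.trace ℝ _
          (fderiv ℝ (endInChart L x) (extChartAt (𝓡 n) x x) w).toLinearMap) := by
  simp only [bilinInChart_self, ← dTrace_apply hL.smooth]
  exact hL.apply_covDerivEnd hg u v w

theorem fderiv_transition_surjective (hz : z ∈ (extChartAt (𝓡 n) c).target)
    (hx : (extChartAt (𝓡 n) c).symm z ∈ (extChartAt (𝓡 n) x).source) :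
    Function.Surjective (fderiv ℝ (transition c x) z) := by
  rw [← ContinuousLinearMap.coe_coe, ← LinearMap.injective_iff_surjective]
  intro u v huv
  rw [← chartCoframe_chartFrame hz u, ← chartCoframe_chartFrame hz v]
  congr 1
  refine (chartFrame_transition hz hx u).symm.trans
    (Eq.trans ?_ (chartFrame_transition hz hx v))
  exact congrArg (chartFrame x (transition c x z)) huv

/-- In every chart, a compatible pair is given by a compatible pair on the chart domain. -/
theorem Compatible.compatibleCoordOn (hg : IsPseudoRiemannianMetric g) (hL : Compatible g L)
    (c : M) :
    CompatibleCoordOn (bilinInChart g c) (endInChart L c) (extChartAt (𝓡 n) c).target where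
  isOpen := isOpen_extChartAt_target c
  contDiffOn_metric := contDiffOn_bilinInChart hg c
  contDiffOn_tensor := contDiffOn_endInChart hL.smooth c
  symm y _ u v := hg.symm _ _ _
  nondegenerate y hy := hg.bilinInChart_nondegenerate hy
  selfadjoint y hy u v := by
    rw [bilinInChart_apply, bilinInChart_apply, chartFrame_endInChart L hy,
      chartFrame_endInChart L hy]
    exact hL.selfadjoint _ _ _
  main y hy u v w := by
    -- At `y` the chart at `c` is compared with the preferred chart at the point `x` over `y`, where
    -- the equation is known; tensoriality transports it.
    set x := (extChartAt (𝓡 n) c).symm y with hx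
    have hxs : (extChartAt (𝓡 n) c).symm y ∈ (extChartAt (𝓡 n) x).source :=
      mem_extChartAt_source x
    have hτx : transition c x y = extChartAt (𝓡 n) x x := rfl
    have hxt := mem_extChartAt_target (I := 𝓡 n) x
    have hev := eventually_mem_source hy hxs
    have hτ := contDiffAt_transition hy hxs
    have hA := differentiableAt_endInChart hL.smooth hxt
    have hA' := differentiableAt_endInChart hL.smooth hy
    have htr : ∀ v, LinearMap.trace ℝ _ (fderiv ℝ (endInChart L c) y v).toLinearMap =
        LinearMap.trace ℝ _ (fderiv ℝ (endInChart L x) (extChartAt (𝓡 n) x x)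
          (fderiv ℝ (transition c x) y v)).toLinearMap := by
      intro v
      have h1 := (hasFDerivAt_trace (y := transition c x y) hA).comp y
        (hτ.differentiableAt (by simp)).hasFDerivAt
      have h2 := h1.congr_of_eventuallyEq (f₁ := fun z ↦ LinearMap.trace ℝ _
        (endInChart L c z).toLinearMap) (by
          filter_upwards [hev] with z hz
          exact trace_endInChart_transition L hz.1 hz.2)
      exact DFunLike.congr_fun ((hasFDerivAt_trace hA').unique h2) v
    have hcov := covDerivTensor_comp (G := bilinInChart g x) (A := endInChart L x) hτ
      (differentiableAt_bilinInChart hg hxt)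
      (differentiableAt_bilinInChart hg hy)
      (hev.mono fun z hz ↦ bilinInChart_transition g hz.1 hz.2)
      (fun u v ↦ hg.symm _ _ _) (hg.bilinInChart_nondegenerate hxt)
      (hg.bilinInChart_nondegenerate hy) (fderiv_transition_surjective hy hxs) hA hA'
      (hev.mono fun z hz ↦ endInChart_transition L hz.1 hz.2) u v
    rw [bilinInChart_transition g hy hxs, bilinInChart_transition g hy hxs,
      bilinInChart_transition g hy hxs, hcov, htr, htr, hτx]
    exact hL.main_self hg x _ _ _

end CompatibleInChart

end GeodEquiv

/-! ### Parallel tensors and the metric `|det A|⁻¹ G(A⁻¹ ·, ·)`. -/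

namespace GeodEquiv

section ParallelTensor

variable {E : Type*} [NormedAddCommGroup E] [NormedSpace ℝ E]
  {G : E → E →L[ℝ] E →L[ℝ] ℝ} {A : E → E →L[ℝ] E} {y : E}

theorem christoffel_comm (hd : DifferentiableAt ℝ G y)
    (hs : ∀ᶠ z in 𝓝 y, ∀ u v, G z u v = G z v u) (u v : E) :
    christoffel G y u v = christoffel G y v u := by
  rw [christoffel, christoffel]
  congr 2
  ext w
  have h := fderiv_symm_apply hd hs w u v
  simp only [sub_apply, add_apply, ContinuousLinearMap.flip_apply]
  rw [h]
  ring

variable [FiniteDimensional ℝ E]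

theorem isInvertible_of_det_ne_zero {B : E →L[ℝ] E}
    (h : LinearMap.det (B : E →ₗ[ℝ] E) ≠ 0) : B.IsInvertible := by
  refine ⟨(LinearMap.equivOfDetNeZero _ h).toContinuousLinearEquiv, ?_⟩
  ext v
  rfl

/-- The Levi-Civita connection is metric. -/
theorem fderiv_eq_christoffel (hd : DifferentiableAt ℝ G y)
    (hs : ∀ᶠ z in 𝓝 y, ∀ u v, G z u v = G z v u) (hnd : ∀ u, (∀ v, G y u v = 0) → u = 0)
    (u v w : E) :
    fderiv ℝ G y u v w = G y (christoffel G y u v) w + G y v (christoffel G y u w) := by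
  have hi := isInvertible_of_nondegenerate hnd
  rw [hs.self_of_nhds v, christoffel_spec hi, christoffel_spec hi, fderiv_symm_apply hd hs u w v,
    fderiv_symm_apply hd hs w u v, fderiv_symm_apply hd hs v u w]
  ring

/-- The determinant of a tensor which is parallel at a point is stationary there. -/
theorem hasFDerivAt_det_of_covDerivTensor_eq_zero (hA : DifferentiableAt ℝ A y)
    (hdet : LinearMap.det (A y : E →ₗ[ℝ] E) ≠ 0)
    (hcov : ∀ u v, covDerivTensor G A y u v = 0) :
    HasFDerivAt (fun z ↦ LinearMap.det (A z : E →ₗ[ℝ] E)) (0 : E →L[ℝ] ℝ) y := by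
  have hdd : DifferentiableAt ℝ (fun T : E →L[ℝ] E ↦ LinearMap.det (T : E →ₗ[ℝ] E)) (A y) :=
    contDiff_linearMap_det.differentiable (n := 1) one_ne_zero _
  have h1 := hdd.hasFDerivAt.comp y hA.hasFDerivAt
  convert! h1 using 1
  ext u
  have hi := isInvertible_of_det_ne_zero hdet
  have h2 := fderiv_linearMap_det hi.self_comp_inverse (fderiv ℝ A y u)
  -- Parallelism reads `∂_u A = A Γ - Γ A`, so `A⁻¹ ∂_u A = Γ - A⁻¹ Γ A` is traceless and Jacobi's
  -- formula gives zero.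
  have h3 : ((A y).inverse ∘L fderiv ℝ A y u).toLinearMap =
      christoffelMap G y u - (A y).inverse.toLinearMap * (christoffelMap G y u * (A y).toLinearMap) := by
    ext v
    change (A y).inverse (fderiv ℝ A y u v) =
      christoffel G y u v - (A y).inverse (christoffel G y u (A y v))
    rw [fderiv_tensor_apply (G := G), hcov, map_add, map_sub, map_zero, hi.inverse_apply_self]
    abel
  rw [ContinuousLinearMap.comp_apply, h2, h3, map_sub, LinearMap.trace_mul_comm, mul_assoc]
  have h4 : (A y).toLinearMap * (A y).inverse.toLinearMap = 1 :=
    congrArg ContinuousLinearMap.toLinearMap hi.self_comp_inverse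
  rw [h4, mul_one, sub_self, mul_zero]
  rfl

/-- If `A` is parallel at `y`, then the metric `|det A|⁻¹ G(A⁻¹ ·, ·)` has the same Christoffel
symbols at `y` as `G`. -/
theorem christoffel_eq_of_covDerivTensor_eq_zero {G' : E → E →L[ℝ] E →L[ℝ] ℝ}
    (hd : DifferentiableAt ℝ G y) (hs : ∀ᶠ z in 𝓝 y, ∀ u v, G z u v = G z v u)
    (hnd : ∀ u, (∀ v, G y u v = 0) → u = 0)
    (hd' : DifferentiableAt ℝ G' y) (hs' : ∀ᶠ z in 𝓝 y, ∀ u v, G' z u v = G' z v u)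
    (hnd' : ∀ u, (∀ v, G' y u v = 0) → u = 0)
    (hA : DifferentiableAt ℝ A y) (hdet : LinearMap.det (A y : E →ₗ[ℝ] E) ≠ 0)
    (hcov : ∀ u v, covDerivTensor G A y u v = 0)
    (hG' : ∀ᶠ z in 𝓝 y, ∀ v w, |LinearMap.det (A z : E →ₗ[ℝ] E)| * G' z (A z v) w = G z v w)
    (u v : E) : christoffel G' y u v = christoffel G y u v := by
  set D : E → ℝ := fun z ↦ |LinearMap.det (A z : E →ₗ[ℝ] E)| with hD
  have hD0 : D y ≠ 0 := abs_ne_zero.mpr hdet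
  have hDd : HasFDerivAt D (0 : E →L[ℝ] ℝ) y := by
    have h := hasFDerivAt_det_of_covDerivTensor_eq_zero hA hdet hcov
    have h2 := (hasDerivAt_abs hdet).comp_hasFDerivAt y h
    rw [smul_zero] at h2
    exact h2
  -- The connection of `G` is metric for `G'` at `y`: differentiate `|det A| G'(A v, w) = G(v, w)`,
  -- where the determinant is stationary and `A` is parallel. Every vector has the form `A v`.
  have hpar : ∀ u v w, fderiv ℝ G' y u v w =
      G' y (christoffel G y u v) w + G' y v (christoffel G y u w) := by
    intro u v w
    obtain ⟨v, rfl⟩ := (isInvertible_of_det_ne_zero hdet).bijective.surjective v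
    have h1 := (hd'.hasFDerivAt.clm_apply (hA.hasFDerivAt.clm_apply
      (hasFDerivAt_const v y))).clm_apply (hasFDerivAt_const w y)
    have h2 := hDd.mul h1
    have h3 := (hd.hasFDerivAt.clm_apply (hasFDerivAt_const v y)).clm_apply
      (hasFDerivAt_const w y)
    have h4 := DFunLike.congr_fun (h2.unique (h3.congr_of_eventuallyEq
      (hG'.mono fun z hz ↦ hz v w))) u
    simp only [add_apply, smul_apply, smul_eq_mul, zero_apply, mul_zero, add_zero,
      ContinuousLinearMap.comp_apply, ContinuousLinearMap.flip_apply, map_zero, zero_add,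
      fderiv_eq_christoffel hd hs hnd, fderiv_tensor_apply (G := G) y u v, hcov] at h4
    have h5 := hG'.self_of_nhds
    rw [← h5, ← h5] at h4
    rw [zero_sub, map_add, map_neg, add_apply, neg_apply] at h4
    apply mul_left_cancel₀ hD0
    linear_combination h4
  -- A torsion-free connection that is metric for `G'` has the Christoffel symbols of `G'`.
  apply christoffel_unique hnd'
  intro w
  have hc := christoffel_comm hd hs
  have hs1 := hs'.self_of_nhds
  rw [hpar, hpar, hpar, hc v u, hc w u, hc w v, hs1 v (christoffel G y u w),
    hs1 u (christoffel G y v w)]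
  ring

end ParallelTensor

end GeodEquiv

/-! ### The metric `ḡ` on the manifold and affine equivalence. -/

namespace GeodEquiv

section ScaledMetric

open Module Set Bundle Filter

variable {n : ℕ} {M : Type*} [TopologicalSpace M] [ChartedSpace (EuclideanSpace ℝ (Fin n)) M]
  {c x : M} {y : EuclideanSpace ℝ (Fin n)}
  {g : BilinField n M} {L : EndField n M}

theorem gBar_apply (g : BilinField n M) (L : EndField n M) (x : M)
    (u v : TangentSpace (𝓡 n) x) : gBar g L x u v =
      1 / |LinearMap.det (L x).toLinearMap| * g x ((L x).inverse u) v := rfl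

variable [IsManifold (𝓡 n) ∞ M]

/-- A field of bilinear forms is smooth if its components are smooth in every chart. -/
theorem contMDiff_of_contDiffOn_bilinInChart
    (h : ∀ c, ContDiffOn ℝ ∞ (bilinInChart g c) (extChartAt (𝓡 n) c).target) :
    ContMDiff (𝓡 n)
      ((𝓡 n).prod 𝓘(ℝ, EuclideanSpace ℝ (Fin n) →L[ℝ] EuclideanSpace ℝ (Fin n) →L[ℝ] ℝ)) ∞
      (fun x ↦ TotalSpace.mk'
        (EuclideanSpace ℝ (Fin n) →L[ℝ] EuclideanSpace ℝ (Fin n) →L[ℝ] ℝ)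
        (E := fun x : M ↦ TangentSpace (𝓡 n) x →L[ℝ] TangentSpace (𝓡 n) x →L[ℝ] ℝ) x (g x)) := by
  intro c
  rw [contMDiffAt_hom_bundle]
  refine ⟨contMDiffAt_id, ?_⟩
  have h1 : ContMDiffAt (𝓡 n) 𝓘(ℝ, EuclideanSpace ℝ (Fin n) →L[ℝ] EuclideanSpace ℝ (Fin n) →L[ℝ] ℝ)
      ∞ (bilinInChart g c ∘ extChartAt (𝓡 n) c) c :=
    ((h c).contDiffAt (extChartAt_target_mem_nhds c)).contMDiffAt.comp c contMDiffAt_extChartAt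
  refine h1.congr_of_eventuallyEq ?_
  filter_upwards [extChartAt_source_mem_nhds (I := 𝓡 n) c] with p hp
  have hpt := (extChartAt (𝓡 n) c).map_source hp
  have hb := mem_baseSet_of_mem_target hpt
  have hs := symmL_eq_chartFrame hpt
  ext u v
  rw [Function.comp_apply, bilinInChart_apply, ← hs, (extChartAt (𝓡 n) c).left_inv hp]
  rw [(extChartAt (𝓡 n) c).left_inv hp] at hb
  rw [inCoordinates_apply_eq₂ hb hb (by simp)]
  rw [Trivialization.symmL_apply _ hb, Trivialization.symmL_apply _ hb]
  simp

theorem Compatible.isInvertible (hL : Compatible g L) (x : M) : (L x).IsInvertible :=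
  isInvertible_of_det_ne_zero (E := EuclideanSpace ℝ (Fin n)) (hL.nondegenerate x)

theorem Compatible.det_endInChart_ne_zero (hL : Compatible g L)
    (hy : y ∈ (extChartAt (𝓡 n) c).target) :
    LinearMap.det (endInChart L c y).toLinearMap ≠ 0 := by
  rw [det_endInChart L hy]
  exact hL.nondegenerate _

/-- The definition of `ḡ` freed of inverse and denominator; as `L` is onto, it determines `ḡ`. -/
theorem Compatible.abs_det_mul_gBar (hL : Compatible g L) (x : M)
    (u v : TangentSpace (𝓡 n) x) :
    |LinearMap.det (L x).toLinearMap| * gBar g L x (L x u) v = g x u v := by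
  rw [gBar_apply, (hL.isInvertible x).inverse_apply_self, ← mul_assoc,
    mul_one_div_cancel (abs_ne_zero.mpr (hL.nondegenerate x)), one_mul]

theorem Compatible.abs_det_mul_bilinInChart_gBar (hL : Compatible g L)
    (hy : y ∈ (extChartAt (𝓡 n) c).target) (u v : EuclideanSpace ℝ (Fin n)) :
    |LinearMap.det (endInChart L c y).toLinearMap| *
      bilinInChart (gBar g L) c y (endInChart L c y u) v = bilinInChart g c y u v := by
  rw [det_endInChart L hy, bilinInChart_apply, bilinInChart_apply, chartFrame_endInChart L hy,
    hL.abs_det_mul_gBar]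

theorem Compatible.bilinInChart_gBar (hL : Compatible g L)
    (hy : y ∈ (extChartAt (𝓡 n) c).target) :
    bilinInChart (gBar g L) c y = (1 / |LinearMap.det (endInChart L c y).toLinearMap|) •
      (bilinInChart g c y ∘L (endInChart L c y).inverse) := by
  ext u v
  have h0 := hL.det_endInChart_ne_zero hy
  obtain ⟨u, rfl⟩ := (isInvertible_of_det_ne_zero h0).bijective.surjective u
  rw [smul_apply, smul_apply, ContinuousLinearMap.comp_apply,
    (isInvertible_of_det_ne_zero h0).inverse_apply_self,
    ← hL.abs_det_mul_bilinInChart_gBar hy, smul_eq_mul, ← mul_assoc,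
    one_div_mul_cancel (abs_ne_zero.mpr h0), one_mul]

/-- `|det L|⁻¹ g(L⁻¹ ·, ·)` is a pseudo-Riemannian metric. -/
theorem Compatible.isPseudoRiemannianMetric_gBar (hg : IsPseudoRiemannianMetric g)
    (hL : Compatible g L) : IsPseudoRiemannianMetric (gBar g L) where
  symm x u v := by
    obtain ⟨u, rfl⟩ := (hL.isInvertible x).bijective.surjective u
    obtain ⟨v, rfl⟩ := (hL.isInvertible x).bijective.surjective v
    rw [gBar_apply, gBar_apply, (hL.isInvertible x).inverse_apply_self,
      (hL.isInvertible x).inverse_apply_self, ← hL.selfadjoint, hg.symm]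
  nondegenerate x u h := by
    obtain ⟨u, rfl⟩ := (hL.isInvertible x).bijective.surjective u
    rw [hg.nondegenerate x u, map_zero]
    intro v
    rw [← hL.abs_det_mul_gBar, h, mul_zero]
  contMDiff := contMDiff_of_contDiffOn_bilinInChart fun c y hy ↦ by
    have ho := (isOpen_extChartAt_target (I := 𝓡 n) c).mem_nhds hy
    have h0 := hL.det_endInChart_ne_zero hy
    have hA := (contDiffOn_endInChart hL.smooth c).contDiffAt ho
    have hG := (contDiffOn_bilinInChart hg c).contDiffAt ho
    have hdet : ContDiffAt ℝ ∞ (fun z ↦ LinearMap.det (endInChart L c z).toLinearMap) y :=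
      contDiff_linearMap_det.contDiffAt.comp y hA
    have hinv : ContDiffAt ℝ ∞ (fun z ↦ (endInChart L c z).inverse) y :=
      (isInvertible_of_det_ne_zero h0).contDiffAt_map_inverse.comp y hA
    have h1 := ((contDiffAt_const (c := (1 : ℝ))).div (hdet.abs h0) (abs_ne_zero.mpr h0)).smul (hG.clm_comp hinv)
    refine (h1.congr_of_eventuallyEq ?_).contDiffWithinAt
    filter_upwards [ho] with z hz
    exact hL.bilinInChart_gBar hz

theorem christoffelCoord_gBar (hg : IsPseudoRiemannianMetric g) (hL : Compatible g L)
    (h : ∀ u v : TangentSpace (𝓡 n) x, covDerivEnd g L x u v = 0)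
    (u v : EuclideanSpace ℝ (Fin n)) :
    christoffelCoord (bilinInChart (gBar g L) x) (extChartAt (𝓡 n) x x) u v =
      christoffelCoord (bilinInChart g x) (extChartAt (𝓡 n) x x) u v := by
  have hg' := hL.isPseudoRiemannianMetric_gBar hg
  have hy := mem_extChartAt_target (I := 𝓡 n) x
  -- `christoffelCoord` and `covDerivEnd` unfold to `christoffel` and `covDerivTensor` on the model
  -- space.
  exact christoffel_eq_of_covDerivTensor_eq_zero (G := bilinInChart g x)
    (G' := bilinInChart (gBar g L) x) (A := endInChart L x)
    (differentiableAt_bilinInChart hg hy) (.of_forall fun z u v ↦ hg.symm _ _ _)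
    (hg.bilinInChart_nondegenerate hy)
    (differentiableAt_bilinInChart hg' hy) (.of_forall fun z u v ↦ hg'.symm _ _ _)
    (hg'.bilinInChart_nondegenerate hy) (differentiableAt_endInChart hL.smooth hy)
    (hL.det_endInChart_ne_zero hy) h
    (Filter.Eventually.mono (extChartAt_target_mem_nhds x)
      fun z hz ↦ hL.abs_det_mul_bilinInChart_gBar hz) u v

/-- The term with the derivative of `Y` does not involve the metric, so equal Christoffel symbols
suffice. -/
theorem affinelyEquivalentOn_gBar (hg : IsPseudoRiemannianMetric g) (hL : Compatible g L)
    {U : Set M} (h : ∀ x ∈ U, ∀ u v : TangentSpace (𝓡 n) x, covDerivEnd g L x u v = 0) :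
    AffinelyEquivalentOn g (gBar g L) U := fun x hx Y _ u ↦
  congrArg (fderiv ℝ (vectorInChart Y x) (extChartAt (𝓡 n) x x) u + ·)
    (christoffelCoord_gBar hg hL (h x hx) u _).symm

end ScaledMetric

end GeodEquiv

/-! ### Eigenvalues of geometric multiplicity at least two on the manifold. -/

namespace GeodEquiv

section Multiplicity

open Module Set Bundle Filter Polynomial

variable {n : ℕ} {M : Type*} [TopologicalSpace M] [ChartedSpace (EuclideanSpace ℝ (Fin n)) M]
  {c x : M} {y : EuclideanSpace ℝ (Fin n)}
  {g : BilinField n M} {L : EndField n M}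

instance (x : M) : FiniteDimensional ℝ (TangentSpace (𝓡 n) x) :=
  inferInstanceAs (FiniteDimensional ℝ (EuclideanSpace ℝ (Fin n)))

theorem finrank_tangentSpace (x : M) : finrank ℝ (TangentSpace (𝓡 n) x) = n :=
  finrank_euclideanSpace_fin (𝕜 := ℝ) (n := n)

theorem nonempty_of_two_le_geomMult {μ : ℂ} (h : 2 ≤ geomMult L x μ) : Nonempty (Fin n) := by
  have h1 : geomMult L x μ ≤ finrank ℂ (TensorProduct ℝ ℂ (TangentSpace (𝓡 n) x)) :=
    Submodule.finrank_le _
  rw [finrank_baseChange, finrank_tangentSpace] at h1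
  exact ⟨⟨0, by lia⟩⟩

/-- The trace of `L` is determined by the real part of its eigenvalues, if all these are equal. -/
theorem trace_eq_of_forall_re_eq {r : ℝ} (h : ∀ μ ∈ eigenvalues L x, μ.re = r) :
    LinearMap.trace ℝ (TangentSpace (𝓡 n) x) (L x).toLinearMap = n * r := by
  have h1 : LinearMap.trace ℂ _ (complexify L x) =
      algebraMap ℝ ℂ (LinearMap.trace ℝ (TangentSpace (𝓡 n) x) (L x).toLinearMap) :=
    LinearMap.trace_baseChange _ ℂ
  have hs : (complexify L x).charpoly.Splits := IsAlgClosed.splits _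
  -- The trace is real and is the sum of the `n` complex roots of the characteristic polynomial, so
  -- it equals the sum of their real parts.
  rw [End.trace_eq_sum_roots_charpoly_of_splits hs] at h1
  have hcard : Multiset.card (complexify L x).charpoly.roots = n := by
    rw [← hs.natDegree_eq_card_roots, LinearMap.charpoly_natDegree, finrank_baseChange,
      finrank_tangentSpace]
  have h2 := congrArg Complex.re h1
  rw [show (algebraMap ℝ ℂ) (LinearMap.trace ℝ (TangentSpace (𝓡 n) x) (L x).toLinearMap) =
    ((LinearMap.trace ℝ (TangentSpace (𝓡 n) x) (L x).toLinearMap : ℝ) : ℂ) from rfl,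
    Complex.ofReal_re, ← Complex.coe_reAddGroupHom, map_multiset_sum] at h2
  have h3 : (complexify L x).charpoly.roots.map Complex.reAddGroupHom = Multiset.replicate n r := by
    rw [Multiset.eq_replicate, Multiset.card_map]
    refine ⟨hcard, fun a ha ↦ ?_⟩
    obtain ⟨μ, hμ, rfl⟩ := Multiset.mem_map.mp ha
    exact h μ ((End.hasEigenvalue_iff_isRoot_charpoly _ _).mpr (isRoot_of_mem_roots hμ))
  rw [← h2, h3, Multiset.sum_replicate, nsmul_eq_mul]

variable [IsManifold (𝓡 n) ∞ M]

theorem Compatible.ne_zero_of_two_le_geomMult (hL : Compatible g L) {μ : ℂ}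
    (h : 2 ≤ geomMult L x μ) : μ ≠ 0 := by
  rintro rfl
  have h1 : LinearMap.det (complexify L x) ≠ 0 := by
    rw [complexify, LinearMap.det_baseChange]
    simpa using hL.nondegenerate x
  have h2 : (complexify L x).eigenspace 0 = ⊥ := by
    rw [End.eigenspace_zero]
    exact (LinearMap.equivOfDetNeZero _ h1).ker
  rw [geomMult, h2, finrank_bot] at h
  lia

/-- In the basis carried over by the chart, `L` has the matrix of its coordinate expression in `b`;
one fixed `b` thus serves the whole chart. -/
theorem two_le_geomMult_iff [Nonempty (Fin n)] (L : EndField n M)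
    (b : Basis (Fin n) ℝ (EuclideanSpace ℝ (Fin n)))
    (hy : y ∈ (extChartAt (𝓡 n) c).target) {μ : ℂ} (hμ : μ ≠ 0) :
    2 ≤ geomMult L ((extChartAt (𝓡 n) c).symm y) μ ↔ (1 - μ⁻¹ • (LinearMap.toMatrix b b
      (endInChart L c y).toLinearMap).map (algebraMap ℝ ℂ)).adjugate = 0 := by
  have h := LinearMap.two_le_finrank_eigenspace_baseChange_iff (b.map (chartFrameEquiv hy))
    (L ((extChartAt (𝓡 n) c).symm y)).toLinearMap hμ
  have hm : LinearMap.toMatrix (b.map (chartFrameEquiv hy)) (b.map (chartFrameEquiv hy))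
      (L ((extChartAt (𝓡 n) c).symm y)).toLinearMap =
      LinearMap.toMatrix b b (endInChart L c y).toLinearMap := by
    ext i j
    rw [LinearMap.toMatrix_apply, LinearMap.toMatrix_apply]
    rfl
  rw [hm] at h
  exact h

variable {U : Set M} {ev : M → ℂ}

/-- A continuous eigenvalue of geometric multiplicity at least two is locally constant. -/
theorem Compatible.eventually_eq (hg : IsPseudoRiemannianMetric g) (hL : Compatible g L)
    (hU : IsOpen U) (hev : ContinuousOn ev U) (h : ∀ x ∈ U, 2 ≤ geomMult L x (ev x)) (hx : x ∈ U) :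
    ∀ᶠ p in 𝓝 x, ev p = ev x := by
  have := nonempty_of_two_le_geomMult (h x hx)
  let b := (EuclideanSpace.basisFun (Fin n) ℝ).toBasis
  set O := (extChartAt (𝓡 n) x).target ∩ (extChartAt (𝓡 n) x).symm ⁻¹' U with hO
  have hOo : IsOpen O := (continuousOn_extChartAt_symm x).isOpen_inter_preimage
    (isOpen_extChartAt_target x) hU
  have hxO : extChartAt (𝓡 n) x x ∈ O := ⟨mem_extChartAt_target x, by simpa using hx⟩
  have h0 : ∀ p ∈ U, ev p ≠ 0 := fun p hp ↦ hL.ne_zero_of_two_le_geomMult (h p hp)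
  have h1 := (hL.compatibleCoordOn hg x).eventually_eq_of_aeval_killingPolynomial b
    (mem_extChartAt_target x) (hOo.mem_nhds hxO) (ν := fun y ↦ (ev ((extChartAt (𝓡 n) x).symm y))⁻¹)
    ((hev.comp ((continuousOn_extChartAt_symm x).mono inter_subset_left) fun y hy ↦ hy.2).inv₀
      fun y hy ↦ h0 _ hy.2) fun y hy v ↦
      aeval_killingPolynomial_eq_zero b ((two_le_geomMult_iff L b hy.1 (h0 _ hy.2)).mp (h _ hy.2)) v
  filter_upwards [(continuousAt_extChartAt (I := 𝓡 n) x).eventually h1,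
    extChartAt_source_mem_nhds (I := 𝓡 n) x] with p hp hps
  rwa [(extChartAt (𝓡 n) x).left_inv hps, extChartAt_to_inv, inv_inj] at hp

theorem Compatible.exists_eq_const (hg : IsPseudoRiemannianMetric g) (hL : Compatible g L)
    (hU : IsOpen U) (hUc : IsConnected U) (hev : ContinuousOn ev U)
    (h : ∀ x ∈ U, 2 ≤ geomMult L x (ev x)) : ∃ c : ℂ, ∀ x ∈ U, ev x = c := by
  obtain ⟨p, hp⟩ := hUc.nonempty
  refine ⟨ev p, fun x hx ↦ ?_⟩
  have : PreconnectedSpace U := isPreconnected_iff_preconnectedSpace.mp hUc.isPreconnected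
  have hlc : IsLocallyConstant fun z : U ↦ ev z :=
    (IsLocallyConstant.iff_eventually_eq _).mpr fun z ↦
      continuous_subtype_val.continuousAt.eventually (hL.eventually_eq hg hU hev h z.2)
  exact hlc.apply_eq_of_preconnectedSpace ⟨x, hx⟩ ⟨p, hp⟩

/-- The interior of the set of points where `μ` is an eigenvalue of geometric multiplicity at least
two is closed. -/
theorem Compatible.isClosed_eventually (hg : IsPseudoRiemannianMetric g) (hL : Compatible g L)
    (μ : ℂ) : IsClosed {x | ∀ᶠ p in 𝓝 x, 2 ≤ geomMult L p μ} := by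
  refine isClosed_of_closure_subset fun x hx ↦ ?_
  obtain ⟨p, hp⟩ := closure_nonempty_iff.mp ⟨x, hx⟩
  have hμ : μ ≠ 0 := hL.ne_zero_of_two_le_geomMult hp.self_of_nhds
  have := nonempty_of_two_le_geomMult hp.self_of_nhds
  let b := (EuclideanSpace.basisFun (Fin n) ℝ).toBasis
  obtain ⟨δ, hδ, hsub, hball⟩ := (hL.compatibleCoordOn hg x).exists_ball_adjugate_eq_zero b
    (mem_extChartAt_target x)
  have hV : ∀ᶠ q in 𝓝 x, q ∈ (extChartAt (𝓡 n) x).source ∧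
      extChartAt (𝓡 n) x q ∈ Metric.ball (extChartAt (𝓡 n) x x) δ :=
    Filter.Eventually.and (extChartAt_source_mem_nhds (I := 𝓡 n) x)
      ((continuousAt_extChartAt (I := 𝓡 n) x).eventually_mem (Metric.ball_mem_nhds _ hδ))
  -- The continuation ball about the limit point `x` contains the image of a point `q` near which
  -- the multiplicity is already at least two; the condition then holds on the whole ball.
  obtain ⟨q, hqV, hq⟩ := mem_closure_iff_nhds.mp hx _ hV
  obtain ⟨O, hO, hOo, hqO⟩ := eventually_nhds_iff.mp hq
  have hadj := hball μ⁻¹ (Metric.ball (extChartAt (𝓡 n) x x) δ ∩ (extChartAt (𝓡 n) x).symm ⁻¹' O)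
    (((continuousOn_extChartAt_symm x).mono hsub).isOpen_inter_preimage Metric.isOpen_ball hOo)
    ⟨extChartAt (𝓡 n) x q, hqV.2, by rwa [mem_preimage, (extChartAt (𝓡 n) x).left_inv hqV.1]⟩
    inter_subset_left fun y hy v ↦ aeval_killingPolynomial_eq_zero b
      ((two_le_geomMult_iff L b (hsub hy.1) hμ).mp (hO _ hy.2)) v
  filter_upwards [hV] with z hz
  have h := (two_le_geomMult_iff L b (hsub hz.2) hμ).mpr (hadj _ hz.2)
  rwa [(extChartAt (𝓡 n) x).left_inv hz.1] at h

theorem Compatible.two_le_geomMult_of_eventually [ConnectedSpace M]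
    (hg : IsPseudoRiemannianMetric g) (hL : Compatible g L) {μ : ℂ}
    (h : ∀ᶠ p in 𝓝 x, 2 ≤ geomMult L p μ) (z : M) : 2 ≤ geomMult L z μ := by
  have hcl : IsClopen {x | ∀ᶠ p in 𝓝 x, 2 ≤ geomMult L p μ} :=
    ⟨hL.isClosed_eventually hg μ, isOpen_iff_mem_nhds.mpr fun _ hy ↦ eventually_eventually_nhds.mpr hy⟩
  have huniv := hcl.eq_univ ⟨x, h⟩
  exact (huniv.ge (mem_univ z) : ∀ᶠ p in 𝓝 z, 2 ≤ geomMult L p μ).self_of_nhds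

/-- Compatibility expresses `∇L` through `d tr L` alone. -/
theorem Compatible.covDerivEnd_eq_zero (hg : IsPseudoRiemannianMetric g) (hL : Compatible g L)
    {t : ℝ} (h : ∀ᶠ p in 𝓝 x, LinearMap.trace ℝ (TangentSpace (𝓡 n) p) (L p).toLinearMap = t)
    (u v : TangentSpace (𝓡 n) x) : covDerivEnd g L x u v = 0 := by
  have h0 : dTrace L x = 0 := by
    have h1 := (hasMFDerivAt_const (I := 𝓡 n) (I' := 𝓘(ℝ, ℝ)) t x).congr_of_eventuallyEq h
    rw [dTrace, h1.mfderiv]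
    rfl
  refine hg.nondegenerate x _ fun w ↦ ?_
  rw [hL.apply_covDerivEnd hg, h0]
  simp

end Multiplicity

end GeodEquiv

/-! ### The local and the global statement. -/

theorem theorem1p3 {n : ℕ} {M : Type*} [TopologicalSpace M]
    [ChartedSpace (EuclideanSpace ℝ (Fin n)) M] [IsManifold (𝓡 n) ∞ M]
    [T2Space M] [SecondCountableTopology M]
    (g : GeodEquiv.BilinField n M) (hg : GeodEquiv.IsPseudoRiemannianMetric g)
    (L : GeodEquiv.EndField n M) (hL : GeodEquiv.Compatible g L) :
    -- the local theorem
    (∀ (p : M) (U : Set M), IsOpen U → IsConnected U → p ∈ U → ∀ ev : M → ℂ,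
      ((∀ x ∈ U, (ev x).im = 0 ∧ GeodEquiv.eigenvalues L x = {ev x}) ∨
        (ContinuousOn ev U ∧ ∀ x ∈ U, (ev x).im ≠ 0 ∧
          GeodEquiv.eigenvalues L x = {ev x, (starRingEnd ℂ) (ev x)})) →
      (∀ x ∈ U, 2 ≤ GeodEquiv.geomMult L x (ev x)) →
      (∃ c : ℂ, ∀ x ∈ U, ev x = c) ∧
      (∀ x ∈ U, ∀ u v : TangentSpace (𝓡 n) x, GeodEquiv.covDerivEnd g L x u v = 0) ∧
      GeodEquiv.IsPseudoRiemannianMetric (GeodEquiv.gBar g L) ∧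
      GeodEquiv.AffinelyEquivalentOn g (GeodEquiv.gBar g L) U) ∧
    -- the global addition, for connected `M`
    (ConnectedSpace M → ∀ U : Set M, IsOpen U → IsConnected U → ∀ ev : M → ℂ,
      ContinuousOn ev U → (∀ x ∈ U, 2 ≤ GeodEquiv.geomMult L x (ev x)) →
      ∃ c : ℂ, (∀ x ∈ U, ev x = c) ∧ ∀ x : M, 2 ≤ GeodEquiv.geomMult L x c) := by
  constructor
  · intro p U hU hUc hp ev hev hmult
    have hn := GeodEquiv.nonempty_of_two_le_geomMult (hmult p hp)
    have hn0 : (n : ℝ) ≠ 0 := by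
      obtain ⟨i⟩ := hn
      have := i.pos
      positivity
    have htr : ∀ x ∈ U, LinearMap.trace ℝ (TangentSpace (𝓡 n) x) (L x).toLinearMap =
        n * (ev x).re := by
      rintro x hx
      apply GeodEquiv.trace_eq_of_forall_re_eq
      rcases hev with hev | ⟨-, hev⟩
      · rw [(hev x hx).2]
        rintro μ rfl
        rfl
      · rw [(hev x hx).2]
        rintro μ (rfl | rfl)
        · rfl
        · exact Complex.conj_re _
    -- In the real case continuity is not assumed; it follows from `ev = tr L / n`.
    have hcont : ContinuousOn ev U := by
      rcases hev with hev | ⟨hev, -⟩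
      · have h1 : Continuous fun x : M ↦
            ((LinearMap.trace ℝ (TangentSpace (𝓡 n) x) (L x).toLinearMap / n : ℝ) : ℂ) :=
          Complex.continuous_ofReal.comp ((GeodEquiv.continuous_trace hL.smooth).div_const _)
        refine h1.continuousOn.congr fun x hx ↦ ?_
        change ev x = ((_ / n : ℝ) : ℂ)
        rw [htr x hx, mul_div_cancel_left₀ _ hn0]
        exact Complex.ext rfl (hev x hx).1
      · exact hev
    obtain ⟨c, hc⟩ := hL.exists_eq_const hg hU hUc hcont hmult
    have hpar : ∀ x ∈ U, ∀ u v : TangentSpace (𝓡 n) x, GeodEquiv.covDerivEnd g L x u v = 0 := by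
      intro x hx
      refine hL.covDerivEnd_eq_zero hg (t := n * c.re) ?_
      filter_upwards [hU.mem_nhds hx] with z hz
      rw [htr z hz, hc z hz]
    exact ⟨⟨c, hc⟩, hpar, hL.isPseudoRiemannianMetric_gBar hg,
      GeodEquiv.affinelyEquivalentOn_gBar hg hL hpar⟩
  · intro _ U hU hUc ev hev hmult
    obtain ⟨c, hc⟩ := hL.exists_eq_const hg hU hUc hev hmult
    obtain ⟨p, hp⟩ := hUc.nonempty
    refine ⟨c, hc, hL.two_le_geomMult_of_eventually hg (x := p) ?_⟩
    filter_upwards [hU.mem_nhds hp] with z hz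
    exact hc z hz ▸ hmult z hz
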